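/- There are absolute constants $s_0,c_0,C,K>0$ such that the following holds for all integers $d,n\ge 1$. Let $\Theta=\{\theta\in\mathbb R^d:\ \theta_j>0\ (1\le j\le d),\ \theta_1+\dots+\theta_d<1\}$ and write $\theta_0=1-\sum_{j=1}^d\theta_j$ for $\theta\in\Theta$. Let $\theta^*\in\Theta$, $\theta^*_{\min}=\min_{0\le j\le d}\theta^*_j$, and let $N=(N_0,\dots,N_d)\sim\mathrm{Multi}(n,\theta^*)$ be the vector of counts of $n$ i.i.d. draws from the pmf $(\theta_0^*,\dots,\theta_d^*)$. Put $$\ell(\theta)=-\sum_{j=0}^d\frac{N_j}{n}\log\theta_j,\qquad F^*=\mathrm{diag}\big((1/\theta_j^*)_{j=1}^d\big)+\frac1{\theta_0^*}\mathbf 1\mathbf 1^{\top},$$ and $|u|_{F^*}=(u^\top F^*u)^{1/2}$, $\|g\|_{F^*}=\sup_{|u|_{F^*}=1}\langle g,u\rangle$ for $u,g\in\mathbb R^d$. Let $\rho$ be a prior density, up to normalization: a function on $\mathbb R^d$ that is nonnegative and integrable on $\Theta$. For $r>0$ let $$U^*(r)=\{\theta\in\mathbb R^d:\ |\theta-\theta^*|_{F^*}\le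 r\sqrt{d/n}\},\qquad \delta^*_{01}(r)=\sup_{\theta\in U^*(r)}\|\nabla\log\rho(\theta)\|_{F^*},$$ with $\delta^*_{01}(r)=\infty$ if $\rho$ is not $C^1$ or not strictly positive on $U^*(r)$, and let $$M_0^*=\frac1d\log\frac{\sup_{\theta\in\Theta}\rho(\theta)}{\rho(\theta^*)}\in[0,\infty].$$ Let $\pi$ be the posterior, i.e. the probability distribution on $\Theta$ with density proportional to $e^{-n\ell(\theta)}\rho(\theta)$. Suppose that $s\ge s_0$, that $\dfrac{s^2d}{n\theta^*_{\min}}\le c_0$, and that $\delta^*_{01}(2s)\le\sqrt{nd}/6$. Then, on an event of probability at least $1-\exp(-Cds^2)$, the posterior $\pi$ is well defined, $\ell$ has a unique minimizer $\hat\theta$ over $\Theta$ (the maximum likelihood estimator), and $$\mathrm{TV}\Big(\pi,\ \mathcal N\big(\hat\theta,(nF^*)^{-1}\big)\Big)\ \le\ K\left(\frac{sd}{\sqrt{n\theta^*_{\min}}}+\frac{\delta^*_{01}(2s)}{\sqrt n}+e^{d(M_0^*-Cs^2)}\right),$$ where $\mathrm{TV}(\mu,\nu)=\sup_A|\mu(A)-\nu(A)|$.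 -/

import Mathlib

open MeasureTheory ProbabilityTheory

namespace MultinomialBvM

/-- The parameter space: the probabilities `(θ₁, …, θ_d)` of the states `1, …, d`, such that all of
the `d + 1` probabilities, including `θ₀ = 1 - θ₁ - ⋯ - θ_d`, are strictly positive. -/
def paramSpace (d : ℕ) : Set (EuclideanSpace ℝ (Fin d)) :=
  {θ | (∀ j, 0 < θ j) ∧ ∑ j, θ j < 1}

/-- The full vector `(θ₀, θ₁, …, θ_d)` with `θ₀ = 1 - θ₁ - ⋯ - θ_d`. -/
def full {d : ℕ} (θ : EuclideanSpace ℝ (Fin d)) : Fin (d + 1) → ℝ :=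
  Fin.cons (1 - ∑ j, θ j) (fun j => θ j)

/-- The smallest of the `d + 1` probabilities. -/
noncomputable def minProb {d : ℕ} (θ : EuclideanSpace ℝ (Fin d)) : ℝ :=
  ⨅ j, full θ j

/-- The law on the states `0, …, d` which gives state `j` the probability `θ_j`. -/
noncomputable def categorical {d : ℕ} (θ : EuclideanSpace ℝ (Fin d)) : Measure (Fin (d + 1)) :=
  ∑ j, ENNReal.ofReal (full θ j) • Measure.dirac j

/-- The vector of counts `N_j = #{i | x_i = j}` of a sample. -/
def counts {d n : ℕ} (x : Fin n → Fin (d + 1)) : Fin (d + 1) → ℕ :=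
  fun j => (Finset.univ.filter fun i => x i = j).card

/-- The multinomial law with `n` trials and probabilities `θ₀, …, θ_d`: the law of the counts of
`n` i.i.d. draws from the pmf. -/
noncomputable def multinomial {d : ℕ} (n : ℕ) (θ : EuclideanSpace ℝ (Fin d)) :
    Measure (Fin (d + 1) → ℕ) :=
  (Measure.pi fun _ : Fin n => categorical θ).map counts

/-- The negative normalized log likelihood `ℓ(θ) = -∑ⱼ (N_j / n) log θ_j`. -/
noncomputable def negLogLik {d : ℕ} (n : ℕ) (N : Fin (d + 1) → ℕ)
    (θ : EuclideanSpace ℝ (Fin d)) : ℝ :=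
  -∑ j, ((N j : ℝ) / n) * Real.log (full θ j)

/-- `θ` is a maximum likelihood estimator: a minimizer of `ℓ` over the parameter space. -/
def IsMLE {d : ℕ} (n : ℕ) (N : Fin (d + 1) → ℕ) (θ : EuclideanSpace ℝ (Fin d)) : Prop :=
  θ ∈ paramSpace d ∧ IsMinOn (negLogLik n N) (paramSpace d) θ

/-- The Fisher information matrix `diag(1 / θ₁, …, 1 / θ_d) + (1 / θ₀) 𝟙 𝟙ᵀ`. -/
noncomputable def fisher {d : ℕ} (θ : EuclideanSpace ℝ (Fin d)) : Matrix (Fin d) (Fin d) ℝ :=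
  Matrix.diagonal (fun j => 1 / θ j) + Matrix.of fun _ _ => 1 / full θ 0

/-- The weighted Euclidean norm `|u|_A = |A^{1/2} u| = (uᵀ A u)^{1/2}`. -/
noncomputable def wnorm {d : ℕ} (A : Matrix (Fin d) (Fin d) ℝ) (u : EuclideanSpace ℝ (Fin d)) : ℝ :=
  Real.sqrt (u.ofLp ⬝ᵥ A.mulVec u.ofLp)

/-- The weighted operator norm `‖S‖_A = sup {⟨S, u⟩ : |u|_A = 1}` of a `1`-linear form, which is
identified with the vector that represents it. -/
noncomputable def wopNorm {d : ℕ} (A : Matrix (Fin d) (Fin d) ℝ) (S : EuclideanSpace ℝ (Fin d)) :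
    ENNReal :=
  ⨆ (u : EuclideanSpace ℝ (Fin d)) (_ : wnorm A u = 1), ENNReal.ofReal (inner ℝ S u)

/-- The local neighbourhood `U*(r) = {θ : |θ - θ*|_{F*} ≤ r √(d/n)}`. -/
def nbhd {d : ℕ} (n : ℕ) (θs : EuclideanSpace ℝ (Fin d)) (r : ℝ) :
    Set (EuclideanSpace ℝ (Fin d)) :=
  {θ | wnorm (fisher θs) (θ - θs) ≤ r * Real.sqrt ((d : ℝ) / n)}

open Classical in
/-- `δ*₀₁(r) = sup {‖∇ log π(θ)‖_{F*} : θ ∈ U*(r)}`, which is `∞` by convention if the prior `π` is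
not strictly positive on `U*(r)` or not `C¹` there (at each point of `U*(r)` it is to have a
gradient, and the gradient is to be continuous on `U*(r)`). -/
noncomputable def delta01 {d : ℕ} (n : ℕ) (θs : EuclideanSpace ℝ (Fin d))
    (prior : EuclideanSpace ℝ (Fin d) → ℝ) (r : ℝ) : ENNReal :=
  if (∀ θ ∈ nbhd n θs r, 0 < prior θ ∧ DifferentiableAt ℝ prior θ) ∧
      ContinuousOn (gradient prior) (nbhd n θs r) then
    ⨆ θ ∈ nbhd n θs r, wopNorm (fisher θs) (gradient (fun η => Real.log (prior η)) θ)
  else ⊤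

/-- `M₀* = d⁻¹ log (sup_{θ ∈ Θ} π(θ) / π(θ*))`, which is `+∞` for an unbounded prior. -/
noncomputable def M0 {d : ℕ} (θs : EuclideanSpace ℝ (Fin d))
    (prior : EuclideanSpace ℝ (Fin d) → ℝ) : EReal :=
  ENNReal.log ((⨆ θ ∈ paramSpace d, ENNReal.ofReal (prior θ)) / ENNReal.ofReal (prior θs)) / (d : EReal)

/-- The unnormalized posterior, with density `e^{-nℓ(θ)} π(θ)` on the parameter space. -/
noncomputable def posteriorWeight {d : ℕ} (n : ℕ) (prior : EuclideanSpace ℝ (Fin d) → ℝ)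
    (N : Fin (d + 1) → ℕ) : Measure (EuclideanSpace ℝ (Fin d)) :=
  (volume.restrict (paramSpace d)).withDensity fun θ =>
    ENNReal.ofReal (Real.exp (-(n * negLogLik n N θ)) * prior θ)

/-- The posterior distribution. -/
noncomputable def posterior {d : ℕ} (n : ℕ) (prior : EuclideanSpace ℝ (Fin d) → ℝ)
    (N : Fin (d + 1) → ℕ) : Measure (EuclideanSpace ℝ (Fin d)) :=
  (posteriorWeight n prior N Set.univ)⁻¹ • posteriorWeight n prior N

/-- The total variation distance `sup_A |μ(A) - ν(A)|` of two probability measures. -/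
noncomputable def tv {α : Type*} [MeasurableSpace α] (μ ν : Measure α) : ENNReal :=
  ⨆ (A : Set α) (_ : MeasurableSet A), ENNReal.ofReal |μ.real A - ν.real A|

end MultinomialBvM

/-! Only the vector p = N/n of relative frequencies is random; once |p - θ*|_{F*} ≤ (s/2)√(d/n), the
rest is deterministic. This event has the required probability by a Chernoff bound averaged over
directions (`multinomial_concentration`). The excess ℓ(θ) - ℓ(p) is the Kullback–Leibler divergence
KL(p‖θ) (`negLogLik_sub`), so p, which lies in Θ on this event, is the unique maximum likelihood
estimator.

Write θ = p + Lx with L = (nF*)^{-1/2}. The Gaussian becomes the standard one, γ, and on the ball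
‖x‖ ≤ s√d the posterior is proportional to e^{-f} γ with f = n KL - ‖x‖²/2 - log ρ. The derivative
of n KL is a Fisher form in which θ* is replaced by p + Lx, a point whose coordinates differ from
those of θ* by a relative amount of order η = s√d/√(nθ*_min). Hence ‖∇f‖ ≤ 4η‖x‖ + δ/√n with δ =
δ*₀₁(2s) (`norm_discrDeriv_le`).

A small gradient makes e^{-f} nearly constant: rotating an independent Gaussian pair (X, Y) bounds
the truncated expectation of e^{2f(Y) - 2f(X)} by that of exp((π²/8)‖2∇f‖²)
(`lintegral_exp_sub_le`). Since ‖x‖² has size d under γ, the bound is 1 + O(η²d + δ²/n) when these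
terms are small. It controls a chi-square divergence, whose square root controls total variation
(`tv_le_of_restrict_eq_withDensity`), and η√d = sd/√(nθ*_min).

Outside the ball, convexity of KL gives linear growth (`linear_growth`), so the unnormalized
posterior mass there is at most sup ρ · e^{-ds²/24}. A unit cube around p shows that the total mass
is at least ρ(θ*) e^{-(d + ds/6)} (`le_pullback_univ`). The quotient produces the third error term.
-/

namespace MultinomialBvM
-- Exponential moments of Gaussian differences by rotation
section Gaussian
open scoped RealInnerProductSpace ENNReal
variable {E : Type*} [NormedAddCommGroup E] [InnerProductSpace ℝ E]

/-- Rotating a pair of points can leave their ball, but only by the factor √2; hence gradients are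
needed on the radius √2 R. -/
lemma norm_cos_smul_add_sin_smul_le {x y : E} {R : ℝ} (hx : ‖x‖ ≤ R) (hy : ‖y‖ ≤ R) (t : ℝ) :
    ‖Real.cos t • x + Real.sin t • y‖ ≤ √2 * R := by
  have hR : 0 ≤ R := (norm_nonneg x).trans hx
  calc _ ≤ |Real.cos t| * R + |Real.sin t| * R := by
        refine (norm_add_le _ _).trans ?_
        simp only [norm_smul, Real.norm_eq_abs]
        gcongr
    _ = (|Real.cos t| + |Real.sin t|) * R := by ring
    _ ≤ _ := by
        gcongr
        apply Real.le_sqrt_of_sq_le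
        nlinarith [sq_abs (Real.cos t), sq_abs (Real.sin t), Real.sin_sq_add_cos_sq t,
          sq_nonneg (|Real.cos t| - |Real.sin t|)]

/-- Jensen's inequality for the uniform law on [0, a]. -/
lemma exp_intervalIntegral_le {f : ℝ → ℝ} {a : ℝ} (ha : 0 < a)
    (hf : ContinuousOn f (Set.Icc 0 a)) :
    ENNReal.ofReal (Real.exp (∫ t in (0 : ℝ)..a, f t)) ≤
      ENNReal.ofReal a⁻¹ * ∫⁻ t in Set.Icc 0 a, ENNReal.ofReal (Real.exp (a * f t)) := by
  have hv : volume.real (Set.Icc (0 : ℝ) a) = a := by simp [ha.le]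
  have hc : ContinuousOn (fun t => a * f t) (Set.Icc 0 a) := continuousOn_const.mul hf
  have hi := hc.integrableOn_Icc (μ := volume)
  have hie : IntegrableOn (fun t => Real.exp (a * f t)) (Set.Icc 0 a) volume :=
    (Real.continuous_exp.comp_continuousOn hc).integrableOn_Icc
  have := convexOn_exp.map_set_average_le Real.continuous_exp.continuousOn isClosed_univ
    (t := Set.Icc 0 a) (μ := volume) (f := fun t => a * f t) (by simp [ha]) (by simp)
    (by simp) hi hie
  rw [setAverage_eq, setAverage_eq, hv, integral_const_mul, smul_eq_mul, smul_eq_mul,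
    inv_mul_cancel_left₀ ha.ne', integral_Icc_eq_integral_Ioc,
    ← intervalIntegral.integral_of_le ha.le] at this
  refine (ENNReal.ofReal_le_ofReal this).trans ?_
  rw [ENNReal.ofReal_mul (by positivity)]
  rw [ofReal_integral_eq_lintegral_ofReal hie (ae_of_all _ fun _ => (Real.exp_pos _).le)]

/-- The quarter circle cos t · x + sin t · y joins x to y, so the increment of G is the integral of
its derivative along it. For independent Gaussian x, y, the position and the velocity are again
independent and standard at every t, which a straight segment would not give. -/
lemma exp_sub_le_lintegral_rotation [CompleteSpace E] {G : E → ℝ} {g : E → E} {R : ℝ}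
    (hG : ∀ x ∈ Metric.closedBall (0 : E) (√2 * R), HasGradientAt G (g x) x)
    (hg : ContinuousOn g (Metric.closedBall 0 (√2 * R))) {x y : E} (hx : ‖x‖ ≤ R) (hy : ‖y‖ ≤ R) :
    ENNReal.ofReal (Real.exp (G y - G x)) ≤ ENNReal.ofReal (Real.pi / 2)⁻¹ *
      ∫⁻ t in Set.Icc 0 (Real.pi / 2), ENNReal.ofReal (Real.exp (Real.pi / 2 *
        ⟪g (Real.cos t • x + Real.sin t • y), -Real.sin t • x + Real.cos t • y⟫)) := by
  have hmem : ∀ t, Real.cos t • x + Real.sin t • y ∈ Metric.closedBall (0 : E) (√2 * R) :=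
    fun t => by simpa using norm_cos_smul_add_sin_smul_le hx hy t
  have hcont : Continuous fun t => ⟪g (Real.cos t • x + Real.sin t • y),
      -Real.sin t • x + Real.cos t • y⟫ := by
    refine Continuous.inner ?_ (by fun_prop)
    exact hg.comp_continuous (by fun_prop) hmem
  have hd : ∀ t, HasDerivAt (fun t => G (Real.cos t • x + Real.sin t • y))
      ⟪g (Real.cos t • x + Real.sin t • y), -Real.sin t • x + Real.cos t • y⟫ t := by
    intro t
    have h1 : HasDerivAt (fun t => Real.cos t • x + Real.sin t • y)
        (-Real.sin t • x + Real.cos t • y) t :=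
      ((Real.hasDerivAt_cos t).smul_const x).add ((Real.hasDerivAt_sin t).smul_const y)
    have h2 := (hG _ (hmem t)).hasFDerivAt.comp_hasDerivAt t h1
    simpa [Function.comp_def] using h2
  have hint := intervalIntegral.integral_eq_sub_of_hasDerivAt (a := 0) (b := Real.pi / 2)
    (fun t _ => hd t) (hcont.intervalIntegrable _ _)
  have := exp_intervalIntegral_le (a := Real.pi / 2) (by positivity) hcont.continuousOn
  rw [hint] at this
  simpa using this

variable [FiniteDimensional ℝ E] [MeasurableSpace E] [BorelSpace E]

lemma lintegral_exp_inner_stdGaussian (v : E) :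
    ∫⁻ y, ENNReal.ofReal (Real.exp ⟪v, y⟫) ∂stdGaussian E =
      ENNReal.ofReal (Real.exp (‖v‖ ^ 2 / 2)) := by
  have h := IsGaussian.map_eq_gaussianReal (μ := stdGaussian E) (innerSL ℝ v)
  rw [integral_strongDual_stdGaussian, variance_dual_stdGaussian] at h
  have h2 := mgf_gaussianReal h 1
  have hint : Integrable (fun y => Real.exp (⟪v, y⟫)) (stdGaussian E) := by
    have : Integrable (fun x : ℝ => Real.exp (1 * x)) ((stdGaussian E).map (innerSL ℝ v)) := by
      rw [h]; exact integrable_exp_mul_gaussianReal 1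
    simpa [Function.comp_def] using this.comp_measurable (by fun_prop)
  rw [← ofReal_integral_eq_lintegral_ofReal hint (ae_of_all _ fun _ => (Real.exp_pos _).le)]
  congr 1
  simpa [mgf, Real.toNNReal_of_nonneg] using h2

lemma lintegral_rotation (t : ℝ) {F : E × E → ℝ≥0∞} (hF : Measurable F) :
    ∫⁻ z, F (Real.cos t • z.1 + Real.sin t • z.2, -Real.sin t • z.1 + Real.cos t • z.2)
      ∂((stdGaussian E).prod (stdGaussian E)) =
      ∫⁻ z, F z ∂((stdGaussian E).prod (stdGaussian E)) := by
  conv_rhs => rw [← IsGaussian.map_rotation_eq_self (μ := stdGaussian E) (by simp) t]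
  rw [lintegral_map hF (by fun_prop)]
  simp [ContinuousLinearMap.rotation_apply]

/-- A truncated form of the inequality of Maurey and Pisier. -/
lemma lintegral_exp_sub_le {G : E → ℝ} {g : E → E} {R : ℝ}
    (hG : ∀ x ∈ Metric.closedBall (0 : E) (√2 * R), HasGradientAt G (g x) x)
    (hg : ContinuousOn g (Metric.closedBall 0 (√2 * R))) :
    ∫⁻ z in Metric.closedBall (0 : E) R ×ˢ Metric.closedBall (0 : E) R,
        ENNReal.ofReal (Real.exp (G z.2 - G z.1)) ∂((stdGaussian E).prod (stdGaussian E)) ≤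
      ∫⁻ x in Metric.closedBall (0 : E) (√2 * R),
        ENNReal.ofReal (Real.exp (Real.pi ^ 2 / 8 * ‖g x‖ ^ 2)) ∂stdGaussian E := by
  set B := Metric.closedBall (0 : E) (√2 * R)
  have hB : MeasurableSet B := Metric.isClosed_closedBall.measurableSet
  set γ := stdGaussian E
  have hgm : Measurable (B.indicator g) := by
    classical
    rw [← Set.piecewise_eq_indicator]
    exact hg.measurable_piecewise continuousOn_const hB
  -- Only the position is truncated. The velocity stays free, so that it can be integrated over its
  -- full Gaussian law once the rotation has been undone.
  let Φ : E × E → ℝ≥0∞ := fun z => (B ×ˢ Set.univ).indicator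
    (fun z => ENNReal.ofReal (Real.exp (Real.pi / 2 * ⟪B.indicator g z.1, z.2⟫))) z
  have hΦ : Measurable Φ := by
    refine Measurable.indicator ?_ (hB.prod .univ)
    have : Measurable fun z : E × E => ⟪B.indicator g z.1, z.2⟫ :=
      (hgm.comp measurable_fst).inner measurable_snd
    fun_prop
  calc _ ≤ ∫⁻ z, ENNReal.ofReal (Real.pi / 2)⁻¹ * ∫⁻ t in Set.Icc 0 (Real.pi / 2),
        Φ (Real.cos t • z.1 + Real.sin t • z.2, -Real.sin t • z.1 + Real.cos t • z.2)
          ∂volume ∂(γ.prod γ) := by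
        rw [← lintegral_indicator (Metric.isClosed_closedBall.measurableSet.prod
          Metric.isClosed_closedBall.measurableSet)]
        refine lintegral_mono fun z => ?_
        by_cases hz : z ∈ Metric.closedBall (0 : E) R ×ˢ Metric.closedBall (0 : E) R
        · rw [Set.indicator_of_mem hz]
          obtain ⟨h1, h2⟩ := hz
          rw [mem_closedBall_zero_iff] at h1 h2
          refine (exp_sub_le_lintegral_rotation hG hg h1 h2).trans (le_of_eq ?_)
          congr 1
          refine lintegral_congr fun t => ?_
          have hmem : Real.cos t • z.1 + Real.sin t • z.2 ∈ B := by
            simpa [B] using norm_cos_smul_add_sin_smul_le h1 h2 t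
          simp [Φ, hmem]
        · simp [Set.indicator_of_notMem hz]
    _ = ENNReal.ofReal (Real.pi / 2)⁻¹ * ∫⁻ t in Set.Icc 0 (Real.pi / 2), ∫⁻ z,
        Φ (Real.cos t • z.1 + Real.sin t • z.2, -Real.sin t • z.1 + Real.cos t • z.2)
          ∂(γ.prod γ) ∂volume := by
        have hm : Measurable (Function.uncurry fun (z : E × E) (t : ℝ) =>
            Φ (Real.cos t • z.1 + Real.sin t • z.2, -Real.sin t • z.1 + Real.cos t • z.2)) := by
          refine hΦ.comp ?_
          fun_prop
        rw [lintegral_const_mul _ hm.lintegral_prod_right,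
          lintegral_lintegral_swap hm.aemeasurable]
    _ = ∫⁻ z, Φ z ∂(γ.prod γ) := by
        simp_rw [γ, lintegral_rotation _ hΦ]
        rw [setLIntegral_const, mul_comm, mul_assoc, Real.volume_Icc, sub_zero,
          ← ENNReal.ofReal_mul (by positivity), mul_inv_cancel₀ (by positivity)]
        simp
    _ = _ := by
        rw [lintegral_prod _ hΦ.aemeasurable, ← lintegral_indicator hB]
        refine lintegral_congr fun x => ?_
        by_cases hx : x ∈ B
        · simp only [Φ, Set.indicator, Set.mem_prod, hx, Set.mem_univ, and_self, if_true]
          -- The Gaussian exponential moment in the velocity gives the constant (π/2)²/2 = π²/8.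
          have := lintegral_exp_inner_stdGaussian ((Real.pi / 2) • g x)
          simp_rw [real_inner_smul_left] at this
          rw [this, norm_smul, mul_pow, Real.norm_eq_abs, sq_abs]
          congr 2; ring
        · simp [Φ, hx]
end Gaussian

/-! ### Density and quadratic exponential moments of the standard Gaussian -/

section GaussianDensity
open scoped RealInnerProductSpace ENNReal
variable {E : Type*} [NormedAddCommGroup E] [InnerProductSpace ℝ E] [FiniteDimensional ℝ E]
  [MeasurableSpace E] [BorelSpace E]

lemma lintegral_exp_neg_mul_sq_norm {b : ℝ} (hb : 0 < b) :
    ∫⁻ x : E, ENNReal.ofReal (Real.exp (-b * ‖x‖ ^ 2)) =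
      ENNReal.ofReal ((Real.pi / b) ^ (Module.finrank ℝ E / 2 : ℝ)) := by
  have h := GaussianFourier.integral_rexp_neg_mul_sq_norm (V := E) hb
  rw [← h, ofReal_integral_eq_lintegral_ofReal _ (ae_of_all _ fun _ => (Real.exp_pos _).le)]
  have := GaussianFourier.integrable_cexp_neg_mul_sq_norm_add (V := E) (b := b) (by simpa) 0 0
  refine this.norm.congr (ae_of_all _ fun x => ?_)
  simp only [Complex.norm_exp]
  norm_num [← Complex.ofReal_pow, ← Complex.ofReal_mul, ← Complex.ofReal_neg]

/-- The two finite measures have the same characteristic function. -/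
lemma stdGaussian_eq_withDensity : stdGaussian E = volume.withDensity fun x =>
    ENNReal.ofReal ((2 * Real.pi) ^ (-(Module.finrank ℝ E / 2 : ℝ)) *
      Real.exp (-(1 / 2) * ‖x‖ ^ 2)) := by
  have hfin : IsFiniteMeasure ((volume : Measure E).withDensity fun x =>
      ENNReal.ofReal ((2 * Real.pi) ^ (-(Module.finrank ℝ E / 2 : ℝ)) *
      Real.exp (-(1 / 2) * ‖x‖ ^ 2))) := by
    refine isFiniteMeasure_withDensity ?_
    simp_rw [ENNReal.ofReal_mul (show 0 ≤ (2 * Real.pi) ^ (-(Module.finrank ℝ E / 2 : ℝ)) by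
      positivity)]
    rw [lintegral_const_mul _ (by fun_prop), lintegral_exp_neg_mul_sq_norm (by norm_num)]
    exact ENNReal.mul_ne_top ENNReal.ofReal_ne_top ENNReal.ofReal_ne_top
  apply Measure.ext_of_charFun
  ext t
  rw [charFun_stdGaussian, charFun_apply,
    integral_withDensity_eq_integral_toReal_smul (by fun_prop) (by simp)]
  have h := GaussianFourier.integral_cexp_neg_mul_sq_norm_add (V := E) (b := (1 / 2 : ℂ))
    (by norm_num) Complex.I t
  have h2 : ∀ x : E, (ENNReal.ofReal ((2 * Real.pi) ^ (-(Module.finrank ℝ E / 2 : ℝ)) *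
      Real.exp (-(1 / 2) * ‖x‖ ^ 2))).toReal • Complex.exp (⟪x, t⟫ * Complex.I) =
      (((2 * Real.pi) ^ (-(Module.finrank ℝ E / 2 : ℝ)) : ℝ) : ℂ) *
      Complex.exp (-(1 / 2) * ‖x‖ ^ 2 + Complex.I * ⟪t, x⟫) := by
    intro x
    rw [ENNReal.toReal_ofReal (by positivity), Complex.real_smul, Complex.exp_add,
      real_inner_comm]
    push_cast
    ring_nf
  simp_rw [h2]
  rw [integral_const_mul, h, Complex.I_sq]
  have : ((Real.pi : ℂ) / (1 / 2)) ^ (Module.finrank ℝ E / 2 : ℂ) =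
      (((2 * Real.pi) ^ (Module.finrank ℝ E / 2 : ℝ) : ℝ) : ℂ) := by
    rw [Complex.ofReal_cpow (by positivity)]
    push_cast
    congr 1
    ring
  rw [this, ← mul_assoc, ← Complex.ofReal_mul, ← Real.rpow_add (by positivity)]
  norm_num

lemma lintegral_exp_mul_sq_norm_stdGaussian {c : ℝ} (hc : c < 1 / 2) :
    ∫⁻ x, ENNReal.ofReal (Real.exp (c * ‖x‖ ^ 2)) ∂stdGaussian E =
      ENNReal.ofReal ((1 - 2 * c) ^ (-(Module.finrank ℝ E / 2 : ℝ))) := by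
  rw [stdGaussian_eq_withDensity, lintegral_withDensity_eq_lintegral_mul _ (by fun_prop)
    (by fun_prop)]
  have : ∀ x : E, ENNReal.ofReal ((2 * Real.pi) ^ (-(Module.finrank ℝ E / 2 : ℝ)) *
      Real.exp (-(1 / 2) * ‖x‖ ^ 2)) * ENNReal.ofReal (Real.exp (c * ‖x‖ ^ 2)) =
      ENNReal.ofReal ((2 * Real.pi) ^ (-(Module.finrank ℝ E / 2 : ℝ))) *
      ENNReal.ofReal (Real.exp (-(1 / 2 - c) * ‖x‖ ^ 2)) := by
    intro x
    rw [← ENNReal.ofReal_mul (by positivity), ← ENNReal.ofReal_mul (by positivity), mul_assoc,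
      ← Real.exp_add]
    ring_nf
  simp only [Pi.mul_apply, this]
  rw [lintegral_const_mul _ (by fun_prop), lintegral_exp_neg_mul_sq_norm (by linarith),
    ← ENNReal.ofReal_mul (by positivity)]
  congr 1
  have e : Real.pi / (1 / 2 - c) = (2 * Real.pi) * (1 - 2 * c)⁻¹ := by
    have : 1 / 2 - c ≠ 0 := by linarith
    have : 1 - 2 * c ≠ 0 := by linarith
    field_simp
  have hc' : 0 ≤ (1 - 2 * c)⁻¹ := by rw [inv_nonneg]; linarith
  rw [e, Real.mul_rpow (x := 2 * Real.pi) (by positivity) hc', ← mul_assoc,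
    ← Real.rpow_add (by positivity), Real.inv_rpow (by linarith), ← Real.rpow_neg (by linarith)]
  simp
end GaussianDensity

/-! ### From exponential moments to total variation -/

section ChiSquare
open scoped ENNReal

/-- A bound of the total variation distance of `e^f μ / Z` to `μ`. -/
lemma abs_setIntegral_exp_div_sub_le {α : Type*} [MeasurableSpace α] {μ : Measure α}
    [IsProbabilityMeasure μ] {f : α → ℝ} (hf : AEMeasurable f μ) {M : ℝ} (hM0 : 0 ≤ M)
    (hM : ∫⁻ z, ENNReal.ofReal (Real.exp (2 * f z.1 - 2 * f z.2)) ∂(μ.prod μ) ≤ ENNReal.ofReal M)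
    (A : Set α) :
    Integrable (fun x => Real.exp (f x)) μ ∧
    |(∫ x in A, Real.exp (f x) ∂μ) / (∫ x, Real.exp (f x) ∂μ) - μ.real A| ≤ √(M - 1) := by
  have key : ∫⁻ z, ENNReal.ofReal (Real.exp (2 * f z.1 - 2 * f z.2)) ∂(μ.prod μ) =
      (∫⁻ x, ENNReal.ofReal (Real.exp (2 * f x)) ∂μ) *
      ∫⁻ x, ENNReal.ofReal (Real.exp (-(2 * f x))) ∂μ := by
    rw [← lintegral_prod_mul (by fun_prop) (by fun_prop)]
    refine lintegral_congr fun z => ?_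
    rw [← ENNReal.ofReal_mul (by positivity), ← Real.exp_add, sub_eq_add_neg]
  rw [key] at hM
  have hpos : ∀ g : α → ℝ, AEMeasurable g μ → ∫⁻ x, ENNReal.ofReal (Real.exp (g x)) ∂μ ≠ 0 := by
    intro g hg h
    rw [lintegral_eq_zero_iff' (by fun_prop)] at h
    obtain ⟨x, hx⟩ := h.exists
    exact absurd hx (by simp [Real.exp_pos])
  have hne : (∫⁻ x, ENNReal.ofReal (Real.exp (2 * f x)) ∂μ) *
      ∫⁻ x, ENNReal.ofReal (Real.exp (-(2 * f x))) ∂μ ≠ ⊤ := (hM.trans_lt ENNReal.ofReal_lt_top).ne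
  have h1 : ∫⁻ x, ENNReal.ofReal (Real.exp (2 * f x)) ∂μ ≠ ⊤ := fun h => hne (by
    rw [h, ENNReal.top_mul (hpos _ (by fun_prop))])
  have h2 : ∫⁻ x, ENNReal.ofReal (Real.exp (-(2 * f x))) ∂μ ≠ ⊤ := fun h => hne (by
    rw [h, ENNReal.mul_top (hpos _ (by fun_prop))])
  have i1 : Integrable (fun x => Real.exp (2 * f x)) μ :=
    (lintegral_ofReal_ne_top_iff_integrable (by fun_prop)
      (ae_of_all _ fun _ => (Real.exp_pos _).le)).1 h1
  have i2 : Integrable (fun x => Real.exp (-(2 * f x))) μ :=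
    (lintegral_ofReal_ne_top_iff_integrable (by fun_prop)
      (ae_of_all _ fun _ => (Real.exp_pos _).le)).1 h2
  have L1 : MemLp (fun x => Real.exp (f x)) 2 μ := by
    rw [memLp_two_iff_integrable_sq (by fun_prop)]
    refine i1.congr (ae_of_all _ fun x => ?_)
    simp [← Real.exp_nat_mul]
  have L2 : MemLp (fun x => Real.exp (-f x)) 2 μ := by
    rw [memLp_two_iff_integrable_sq (by fun_prop)]
    refine i2.congr (ae_of_all _ fun x => ?_)
    simp [← Real.exp_nat_mul]
  have e1 := L1.integrable (by norm_num)
  have e2 := L2.integrable (by norm_num)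
  refine ⟨e1, ?_⟩
  set Z := ∫ x, Real.exp (f x) ∂μ
  set W := ∫ x, Real.exp (-f x) ∂μ
  set a := ∫ x, Real.exp (2 * f x) ∂μ
  set m := ∫ x, Real.exp (-(2 * f x)) ∂μ
  have hZ : 0 < Z := integral_exp_pos e1
  have hW : 0 < W := integral_exp_pos e2
  have hm : 0 < m := integral_exp_pos i2
  have ham : a * m ≤ M := by
    rw [← ofReal_integral_eq_lintegral_ofReal i1 (ae_of_all _ fun _ => (Real.exp_pos _).le),
      ← ofReal_integral_eq_lintegral_ofReal i2 (ae_of_all _ fun _ => (Real.exp_pos _).le),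
      ← ENNReal.ofReal_mul (integral_exp_pos i1).le] at hM
    exact (ENNReal.ofReal_le_ofReal_iff hM0).1 hM
  -- The hypothesis controls only the product a m, while the chi-square divergence is a/Z² - 1. The
  -- gap is closed by m ≥ W² ≥ Z⁻², two instances of Cauchy–Schwarz.
  have hWm : W ^ 2 ≤ m := by
    have := variance_nonneg (fun x => Real.exp (-f x)) μ
    rw [variance_eq_sub L2] at this
    have e : μ[(fun x => Real.exp (-f x)) ^ 2] = m :=
      integral_congr_ae (ae_of_all _ fun x => by simp [← Real.exp_nat_mul])
    rw [e] at this
    linarith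
  have hZW : 1 ≤ Z * W := by
    have h : ∫ x, (Real.exp (f x) * W + Real.exp (-f x) * Z) ∂μ = 2 * (Z * W) := by
      rw [integral_add (e1.mul_const _) (e2.mul_const _), integral_mul_const, integral_mul_const]
      ring
    have h' : 2 * √(Z * W) ≤ ∫ x, (Real.exp (f x) * W + Real.exp (-f x) * Z) ∂μ := by
      have : ∫ x, (2 * √(Z * W)) ∂μ = 2 * √(Z * W) := by simp
      rw [← this]
      refine integral_mono (by fun_prop) ((e1.mul_const _).add (e2.mul_const _)) fun x => ?_
      have hx : Real.exp (f x) * W * (Real.exp (-f x) * Z) = Z * W := by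
        rw [Real.exp_neg]; field_simp
      have := Real.sq_sqrt (mul_pos hZ hW).le
      refine abs_le_of_sq_le_sq' ?_ (by positivity) |>.2
      nlinarith [sq_nonneg (Real.exp (f x) * W - Real.exp (-f x) * Z)]
    rw [h] at h'
    have h3 := Real.sq_sqrt (mul_pos hZ hW).le
    have h4 : 0 < √(Z * W) := Real.sqrt_pos.2 (mul_pos hZ hW)
    nlinarith
  have hfin : a / Z ^ 2 ≤ M := by
    rw [div_le_iff₀ (by positivity)]
    have hZm : 1 ≤ Z ^ 2 * m := by nlinarith [mul_pos hZ hW, sq_nonneg Z]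
    have ha : 0 < a := integral_exp_pos i1
    nlinarith [mul_le_mul_of_nonneg_left ham (sq_nonneg Z)]
  have hD : ∫ x, (Real.exp (f x) / Z - 1) ^ 2 ∂μ = a / Z ^ 2 - 1 := by
    have : ∀ x, (Real.exp (f x) / Z - 1) ^ 2 =
        Real.exp (2 * f x) / Z ^ 2 - 2 / Z * Real.exp (f x) + 1 := by
      intro x
      rw [two_mul, Real.exp_add]; ring
    simp_rw [this]
    have j1 := i1.div_const (Z ^ 2)
    have j2 := e1.const_mul (2 / Z)
    rw [integral_add (j1.sub j2 : Integrable (fun x => _ - _) μ) (integrable_const 1),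
      integral_sub j1 j2, integral_div, integral_const_mul]
    change a / Z ^ 2 - 2 / Z * Z + _ = _
    simp [div_mul_cancel₀ _ hZ.ne']
    ring
  have hDL : MemLp (fun x => Real.exp (f x) / Z - 1) 2 μ :=
    (L1.mul_const Z⁻¹).sub (memLp_const 1)
  have hA' : (∫ x in A, Real.exp (f x) ∂μ) / Z - μ.real A =
      ∫ x in A, (Real.exp (f x) / Z - 1) ∂μ := by
    rw [integral_sub (e1.div_const _).integrableOn (by fun_prop), integral_div]
    simp
  rw [hA']
  -- The L¹ norm of the density minus one is at most its L² norm.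
  have hvar := variance_nonneg (fun x => |Real.exp (f x) / Z - 1|) μ
  have hDL' : MemLp (fun x => |Real.exp (f x) / Z - 1|) 2 μ := hDL.abs
  rw [variance_eq_sub hDL'] at hvar
  have e : μ[(fun x => |Real.exp (f x) / Z - 1|) ^ 2] = a / Z ^ 2 - 1 := by
    rw [← hD]; exact integral_congr_ae (ae_of_all _ fun x => by simp)
  rw [e] at hvar
  have hDi := (hDL.integrable (by norm_num)).abs
  calc |∫ x in A, (Real.exp (f x) / Z - 1) ∂μ| ≤ ∫ x in A, |Real.exp (f x) / Z - 1| ∂μ :=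
        abs_integral_le_integral_abs
    _ ≤ ∫ x, |Real.exp (f x) / Z - 1| ∂μ :=
        setIntegral_le_integral hDi (ae_of_all _ fun _ => abs_nonneg _)
    _ ≤ _ := by
        apply Real.le_sqrt_of_sq_le
        linarith

/-- Both laws are conditioned on B, where the chi-square bound applies; dividing by γ(B)² comes from
normalizing the product measure. Undoing each conditioning costs at most the mass of the complement
of B, and the factor c cancels on normalization. -/
lemma tv_le_of_restrict_eq_withDensity {α : Type*} [MeasurableSpace α] {γ ν : Measure α}
    [IsProbabilityMeasure γ] [IsFiniteMeasure ν] {B : Set α} (hB : MeasurableSet B) {f : α → ℝ}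
    (hf : AEMeasurable f (γ.restrict B)) {c : ℝ≥0∞} (hc : c ≠ 0) (hc' : c ≠ ⊤)
    (hν : ν.restrict B =
      c • (γ.restrict B).withDensity fun x => ENNReal.ofReal (Real.exp (f x)))
    (hγB : γ B ≠ 0) {M : ℝ} (hM0 : 0 ≤ M)
    (hM : ∫⁻ z in B ×ˢ B, ENNReal.ofReal (Real.exp (2 * f z.1 - 2 * f z.2)) ∂(γ.prod γ) ≤
      ENNReal.ofReal M) :
    tv ((ν Set.univ)⁻¹ • ν) γ ≤ ENNReal.ofReal (√(M / γ.real B ^ 2 - 1) +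
      2 * γ.real Bᶜ + 2 * (ν.real Bᶜ / ν.real Set.univ)) := by
  have hq : 0 < γ.real B := by
    rw [measureReal_def, ENNReal.toReal_pos_iff]
    exact ⟨hγB.bot_lt, measure_lt_top _ _⟩
  set μ : Measure α := (γ B)⁻¹ • γ.restrict B with hμ
  have hμp : IsProbabilityMeasure μ := cond_isProbabilityMeasure hγB
  have hγBt : γ B ≠ ⊤ := measure_ne_top _ _
  have hM' : ∫⁻ z, ENNReal.ofReal (Real.exp (2 * f z.1 - 2 * f z.2)) ∂(μ.prod μ) ≤
      ENNReal.ofReal (M / γ.real B ^ 2) := by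
    rw [hμ, Measure.prod_smul_left, Measure.prod_smul_right, Measure.prod_restrict,
      lintegral_smul_measure, lintegral_smul_measure, smul_eq_mul, smul_eq_mul, ← mul_assoc,
      div_eq_inv_mul, ENNReal.ofReal_mul (by positivity), sq, mul_inv,
      ENNReal.ofReal_mul (by positivity), ENNReal.ofReal_inv_of_pos hq, ofReal_measureReal hγBt]
    gcongr
  have hfμ : AEMeasurable f μ := hf.smul_measure _
  have hνA : ∀ A, MeasurableSet A → ν (A ∩ B) =
      c * γ B * ENNReal.ofReal (∫ x in A, Real.exp (f x) ∂μ) := by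
    intro A hA
    have hint := (abs_setIntegral_exp_div_sub_le hfμ (by positivity) hM' A).1
    rw [← Measure.restrict_apply hA, hν, Measure.smul_apply, smul_eq_mul, withDensity_apply _ hA,
      mul_assoc, ofReal_integral_eq_lintegral_ofReal hint.integrableOn
        (ae_of_all _ fun _ => (Real.exp_pos _).le), hμ, Measure.restrict_smul,
      lintegral_smul_measure, smul_eq_mul, ← mul_assoc (γ B), ENNReal.mul_inv_cancel hγB hγBt,
      one_mul]
  set C := (c * γ B).toReal with hC
  have hC0 : 0 < C := by
    rw [hC, ENNReal.toReal_pos_iff]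
    exact ⟨(mul_ne_zero hc hγB).bot_lt, (ENNReal.mul_ne_top hc' hγBt).lt_top⟩
  have hνA' : ∀ A, MeasurableSet A → ν.real (A ∩ B) = C * ∫ x in A, Real.exp (f x) ∂μ := by
    intro A hA
    rw [measureReal_def, hνA A hA, ENNReal.toReal_mul, ENNReal.toReal_ofReal]
    exact integral_nonneg fun _ => (Real.exp_pos _).le
  unfold tv
  refine iSup₂_le fun A hA => ENNReal.ofReal_le_ofReal ?_
  obtain ⟨hint, hAbs⟩ := abs_setIntegral_exp_div_sub_le hfμ (by positivity) hM' A
  set Z := ∫ x, Real.exp (f x) ∂μ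
  have hZ : 0 < Z := integral_exp_pos hint
  set I := ∫ x in A, Real.exp (f x) ∂μ
  have hI0 : 0 ≤ I := integral_nonneg fun _ => (Real.exp_pos _).le
  have hIZ : I ≤ Z := setIntegral_le_integral hint (ae_of_all _ fun _ => (Real.exp_pos _).le)
  have hνB : ν.real B = C * Z := by
    have := hνA' Set.univ .univ
    simpa using this
  have hνu : ν.real Set.univ = C * Z + ν.real Bᶜ := by
    rw [← hνB, measureReal_add_measureReal_compl hB]
  set T := ν.real Bᶜ
  have hT : 0 ≤ T := measureReal_nonneg
  have hνAB : ν.real A = C * I + ν.real (A ∩ Bᶜ) := by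
    rw [← hνA' A hA, ← Set.sdiff_eq, measureReal_inter_add_sdiff hB]
  have hT1 : ν.real (A ∩ Bᶜ) ≤ T := measureReal_mono Set.inter_subset_right
  have hT2 : 0 ≤ ν.real (A ∩ Bᶜ) := measureReal_nonneg
  have hγA : γ.real A = γ.real B * μ.real A + γ.real (A ∩ Bᶜ) := by
    have : γ.real B * μ.real A = γ.real (A ∩ B) := by
      rw [hμ, measureReal_ennreal_smul_apply, ENNReal.toReal_inv, ← measureReal_def,
        mul_inv_cancel_left₀ hq.ne', measureReal_restrict_apply hA]
    rw [this, ← Set.sdiff_eq, measureReal_inter_add_sdiff hB]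
  have hγ1 : γ.real (A ∩ Bᶜ) ≤ γ.real Bᶜ := measureReal_mono Set.inter_subset_right
  have hγ2 : 0 ≤ γ.real (A ∩ Bᶜ) := measureReal_nonneg
  have hγB' : γ.real B = 1 - γ.real Bᶜ := by
    rw [← probReal_add_probReal_compl hB (μ := γ)]; ring
  have hQ1 : μ.real A ≤ 1 := measureReal_le_one
  have hQ0 : 0 ≤ μ.real A := measureReal_nonneg
  have hS : 0 < C * Z + T := by positivity
  rw [measureReal_ennreal_smul_apply, ENNReal.toReal_inv, ← measureReal_def, hνAB, hγA, hνu]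
  have e1 : (C * Z + T)⁻¹ * (C * I + ν.real (A ∩ Bᶜ)) =
      I / Z - (T / (C * Z + T)) * (I / Z) + ν.real (A ∩ Bᶜ) / (C * Z + T) := by
    field_simp
    ring
  have h1 : ν.real (A ∩ Bᶜ) / (C * Z + T) ≤ T / (C * Z + T) := by gcongr
  have h2 : 0 ≤ ν.real (A ∩ Bᶜ) / (C * Z + T) := by positivity
  have h3 : 0 ≤ T / (C * Z + T) := by positivity
  have h4 : I / Z ≤ 1 := (div_le_one hZ).2 hIZ
  have h5 : 0 ≤ I / Z := by positivity
  have e2 : γ.real B * μ.real A = μ.real A - γ.real Bᶜ * μ.real A := by rw [hγB']; ring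
  rw [e1, e2]
  have g1 := mul_nonneg h3 h5
  have g2 := mul_le_mul_of_nonneg_left h4 h3
  have g3 := mul_nonneg (hγ2.trans hγ1) hQ0
  have g4 := mul_le_mul_of_nonneg_left hQ1 (hγ2.trans hγ1)
  rw [abs_le] at hAbs ⊢
  constructor <;> linarith [hAbs.1, hAbs.2]
end ChiSquare

/-! ### The Fisher metric in the d + 1 coordinates of the simplex -/

section Geometry
open scoped RealInnerProductSpace MatrixOrder
variable {d : ℕ}

/-- The tangent vector `(-∑ⱼ uⱼ, u₁, …, u_d)` of the simplex. -/
def ext (u : EuclideanSpace ℝ (Fin d)) : Fin (d + 1) → ℝ :=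
  Fin.cons (-∑ j, u j) (fun j => u j)

lemma sum_ext (u : EuclideanSpace ℝ (Fin d)) : ∑ j, ext u j = 0 := by
  simp [ext, Fin.sum_univ_succ]

lemma sum_full (θ : EuclideanSpace ℝ (Fin d)) : ∑ j, full θ j = 1 := by
  simp [full, Fin.sum_univ_succ]

lemma full_add (θ u : EuclideanSpace ℝ (Fin d)) (j : Fin (d + 1)) :
    full (θ + u) j = full θ j + ext u j := by
  refine Fin.cases ?_ (fun i => ?_) j
  · simp [full, ext, Finset.sum_add_distrib]; ring
  · simp [full, ext]

lemma ext_sub (η θ : EuclideanSpace ℝ (Fin d)) (j : Fin (d + 1)) :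
    ext (η - θ) j = full η j - full θ j := by
  have := full_add θ (η - θ) j
  rw [add_sub_cancel] at this
  rw [this]; ring

lemma ext_add (u v : EuclideanSpace ℝ (Fin d)) (j : Fin (d + 1)) :
    ext (u + v) j = ext u j + ext v j := by
  refine Fin.cases ?_ (fun i => ?_) j
  · simp [ext, Finset.sum_add_distrib]; ring
  · simp [ext]

lemma ext_smul (c : ℝ) (u : EuclideanSpace ℝ (Fin d)) (j : Fin (d + 1)) :
    ext (c • u) j = c * ext u j := by
  refine Fin.cases ?_ (fun i => ?_) j
  · simp [ext, Finset.mul_sum]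
  · simp [ext]

lemma full_pos {θ : EuclideanSpace ℝ (Fin d)} (hθ : θ ∈ paramSpace d) (j : Fin (d + 1)) :
    0 < full θ j := by
  refine Fin.cases ?_ (fun i => ?_) j
  · simpa [full] using hθ.2
  · simpa [full] using hθ.1 i

lemma mem_paramSpace_iff {θ : EuclideanSpace ℝ (Fin d)} :
    θ ∈ paramSpace d ↔ ∀ j, 0 < full θ j := by
  refine ⟨full_pos, fun h => ⟨fun j => by simpa [full] using h j.succ, ?_⟩⟩
  simpa [full] using h 0

lemma minProb_le (θ : EuclideanSpace ℝ (Fin d)) (j : Fin (d + 1)) : minProb θ ≤ full θ j :=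
  ciInf_le (Set.finite_range _).bddBelow j

lemma minProb_pos {θ : EuclideanSpace ℝ (Fin d)} (hθ : θ ∈ paramSpace d) : 0 < minProb θ := by
  obtain ⟨j, hj⟩ := exists_eq_ciInf_of_finite (f := full θ)
  unfold minProb
  rw [← hj]
  exact full_pos hθ j

/-- The inner product given by the Fisher information matrix. -/
noncomputable def fisherInner (θ u v : EuclideanSpace ℝ (Fin d)) : ℝ :=
  ∑ j, ext u j * ext v j / full θ j

/-- The rank-one term 𝟙𝟙ᵀ/θ₀ is the summand of state 0, whose tangent coordinate is -∑ u_j. All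
states are then on an equal footing. -/
lemma dotProduct_fisher_mulVec (θ u v : EuclideanSpace ℝ (Fin d)) :
    u.ofLp ⬝ᵥ (fisher θ).mulVec v.ofLp = fisherInner θ u v := by
  unfold fisher fisherInner
  rw [Matrix.add_mulVec, dotProduct_add, Fin.sum_univ_succ, add_comm]
  congr 1
  · simp only [dotProduct, Matrix.mulVec, Matrix.of_apply, ext, Fin.cons_zero]
    rw [← Finset.mul_sum, ← Finset.sum_mul]
    ring
  · simp only [dotProduct, Matrix.mulVec_diagonal, ext, Fin.cons_succ, full]
    exact Finset.sum_congr rfl fun i _ => by ring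

lemma wnorm_fisher (θ u : EuclideanSpace ℝ (Fin d)) :
    wnorm (fisher θ) u = √(fisherInner θ u u) := by
  rw [wnorm, dotProduct_fisher_mulVec]

lemma fisherInner_self_nonneg {θ : EuclideanSpace ℝ (Fin d)} (hθ : θ ∈ paramSpace d)
    (u : EuclideanSpace ℝ (Fin d)) : 0 ≤ fisherInner θ u u :=
  Finset.sum_nonneg fun j _ => div_nonneg (mul_self_nonneg _) (full_pos hθ j).le

lemma wnorm_fisher_sq {θ : EuclideanSpace ℝ (Fin d)} (hθ : θ ∈ paramSpace d)
    (u : EuclideanSpace ℝ (Fin d)) :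
    wnorm (fisher θ) u ^ 2 = ∑ j, ext u j ^ 2 / full θ j := by
  rw [wnorm_fisher, Real.sq_sqrt (fisherInner_self_nonneg hθ u), fisherInner]
  simp_rw [sq]

lemma ext_sq_le {θ : EuclideanSpace ℝ (Fin d)} (hθ : θ ∈ paramSpace d)
    (u : EuclideanSpace ℝ (Fin d)) (j : Fin (d + 1)) :
    ext u j ^ 2 ≤ full θ j * wnorm (fisher θ) u ^ 2 := by
  rw [wnorm_fisher_sq hθ, mul_comm, ← div_le_iff₀ (full_pos hθ j)]
  exact Finset.single_le_sum (f := fun j => ext u j ^ 2 / full θ j)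
    (fun i _ => div_nonneg (sq_nonneg _) (full_pos hθ i).le) (Finset.mem_univ j)

/-- A single summand of the squared norm gives |u_j|/θ_j ≤ |u|/√θ_j. This is where θ_min enters:
bounded relative changes of the coordinates are what both the Chernoff bound and the expansion of
the logarithm require. -/
lemma abs_ext_le {θ : EuclideanSpace ℝ (Fin d)} (hθ : θ ∈ paramSpace d)
    (u : EuclideanSpace ℝ (Fin d)) (j : Fin (d + 1)) :
    |ext u j| ≤ full θ j * (wnorm (fisher θ) u / √(minProb θ)) := by
  have h0 := full_pos hθ j
  have hm := minProb_pos hθ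
  apply abs_le_of_sq_le_sq _ (mul_nonneg h0.le (div_nonneg (Real.sqrt_nonneg _)
    (Real.sqrt_nonneg _)))
  refine (ext_sq_le hθ u j).trans ?_
  rw [mul_pow, div_pow, Real.sq_sqrt hm.le, sq (full θ j), mul_assoc]
  refine mul_le_mul_of_nonneg_left ?_ h0.le
  rw [mul_div_assoc', le_div_iff₀ hm, mul_comm]
  exact mul_le_mul_of_nonneg_right (minProb_le θ j) (sq_nonneg _)

lemma posDef_fisher {θ : EuclideanSpace ℝ (Fin d)} (hθ : θ ∈ paramSpace d) :
    (fisher θ).PosDef := by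
  refine Matrix.PosDef.of_dotProduct_mulVec_pos ?_ fun x hx => ?_
  · ext i j
    simp [fisher, Matrix.diagonal, eq_comm]
    split_ifs with h <;> simp_all
  · have := dotProduct_fisher_mulVec θ (WithLp.toLp 2 x) (WithLp.toLp 2 x)
    simp only [star_trivial]
    rw [this]
    obtain ⟨i, hi⟩ := Function.ne_iff.1 hx
    refine Finset.sum_pos' (fun j _ => div_nonneg (mul_self_nonneg _) (full_pos hθ j).le)
      ⟨i.succ, Finset.mem_univ _, div_pos (mul_self_pos.2 ?_) (full_pos hθ _)⟩
    simpa [ext] using hi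

/-- L is the positive square root A of (nF)⁻¹, the map through which the Gaussian is defined; the
isometry is A (nF) A = 1. -/
lemma exists_continuousLinearEquiv {θ : EuclideanSpace ℝ (Fin d)} (hθ : θ ∈ paramSpace d)
    {n : ℝ} (hn : 0 < n) :
    ∃ L : EuclideanSpace ℝ (Fin d) ≃L[ℝ] EuclideanSpace ℝ (Fin d),
      (∀ μ, multivariateGaussian μ (n • fisher θ)⁻¹ =
        (stdGaussian (EuclideanSpace ℝ (Fin d))).map fun x => μ + L x) ∧
      ∀ x y, n * fisherInner θ (L x) (L y) = ⟪x, y⟫ := by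
  have hP : (n • fisher θ).PosDef := (posDef_fisher hθ).smul hn
  have hdet : IsUnit (n • fisher θ).det := hP.isUnit.map Matrix.detMonoidHom
  set S := (n • fisher θ)⁻¹
  have hS : S.PosSemidef := hP.inv.posSemidef
  set A := CFC.sqrt S
  have hAA : A * A = S := CFC.sqrt_mul_sqrt_self S hS.nonneg
  have hAt : A.transpose = A := by
    have : star A = A := (CFC.sqrt_nonneg S).isSelfAdjoint.star_eq
    rwa [Matrix.star_eq_conjTranspose, Matrix.conjTranspose_eq_transpose_of_trivial] at this
  have hone : A * (n • fisher θ) * A = 1 := by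
    apply mul_eq_one_comm.1
    rw [← mul_assoc, hAA]
    exact Matrix.nonsing_inv_mul _ hdet
  have key : ∀ x y : EuclideanSpace ℝ (Fin d),
      n * fisherInner θ (Matrix.toEuclideanCLM (𝕜 := ℝ) A x) (Matrix.toEuclideanCLM (𝕜 := ℝ) A y) =
        ⟪x, y⟫ := by
    intro x y
    rw [← dotProduct_fisher_mulVec, ← smul_eq_mul, ← dotProduct_smul, ← Matrix.smul_mulVec,
      Matrix.ofLp_toEuclideanCLM, Matrix.ofLp_toEuclideanCLM, Matrix.mulVec_mulVec]
    rw [← Matrix.vecMul_transpose, hAt, ← Matrix.dotProduct_mulVec, Matrix.mulVec_mulVec,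
      ← mul_assoc, hone, Matrix.one_mulVec, PiLp.inner_apply, dotProduct]
    simp [mul_comm]
  have hinj : Function.Injective (Matrix.toEuclideanCLM (𝕜 := ℝ) A).toLinearMap := by
    rw [← LinearMap.ker_eq_bot, LinearMap.ker_eq_bot']
    intro x hx
    have := key x x
    have hx' : Matrix.toEuclideanCLM (𝕜 := ℝ) A x = 0 := hx
    rw [hx'] at this
    have h0 : fisherInner θ 0 0 = 0 := by
      rw [← dotProduct_fisher_mulVec]; simp
    rw [h0, mul_zero] at this
    exact inner_self_eq_zero.1 this.symm
  refine ⟨(LinearEquiv.ofInjectiveEndo _ hinj).toContinuousLinearEquiv, fun μ => rfl, key⟩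
end Geometry

/-! ### Concentration of the relative frequencies -/

section Concentration
open scoped RealInnerProductSpace ENNReal
variable {d : ℕ}

/-- A Chernoff bound for the norm of a random vector: the exponential moments are averaged over a
ball of directions. -/
lemma measure_norm_ge_le {Ω E : Type*} [MeasurableSpace Ω] {P : Measure Ω} [SFinite P]
    [NormedAddCommGroup E] [InnerProductSpace ℝ E] [FiniteDimensional ℝ E] [MeasurableSpace E]
    [BorelSpace E] {z : Ω → E} (hz : Measurable z) {R T : ℝ} (hR : 0 < R) (hT : 0 < T)
    (hmgf : ∀ u : E, ‖u‖ ≤ R →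
      ∫⁻ ω, ENNReal.ofReal (Real.exp ⟪z ω, u⟫) ∂P ≤ ENNReal.ofReal (Real.exp (R ^ 2))) :
    P {ω | T ≤ ‖z ω‖} ≤
      ENNReal.ofReal (4 ^ Module.finrank ℝ E * Real.exp (R ^ 2 - R * T / 2)) := by
  set D := Module.finrank ℝ E
  set V := (volume : Measure E) (Metric.closedBall 0 R) with hV
  have hV0 : V ≠ 0 := (Metric.measure_closedBall_pos _ _ hR).ne'
  have hVt : V ≠ ⊤ := measure_closedBall_lt_top.ne
  have hlow : ∀ ω, T ≤ ‖z ω‖ → ENNReal.ofReal (Real.exp (R * T / 2)) *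
      (ENNReal.ofReal ((1 / 4) ^ D) * V) ≤
      ∫⁻ u in Metric.closedBall (0 : E) R, ENNReal.ofReal (Real.exp ⟪z ω, u⟫) := by
    intro ω hω
    have hzp : 0 < ‖z ω‖ := hT.trans_le hω
    -- The ball of radius R/4 around e lies in the ball of radius R, and on it ⟨z, u⟩ ≥ (3R/4 -
    -- R/4)‖z‖ ≥ RT/2. Its share 4^{-D} of the volume is the price for treating all directions at
    -- once.
    set e := (3 * R / 4 / ‖z ω‖) • z ω
    have he : ‖e‖ = 3 * R / 4 := by
      rw [norm_smul, Real.norm_of_nonneg (by positivity)]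
      field_simp
    have hvol : (volume : Measure E) (Metric.closedBall e (1 / 4 * R)) =
        ENNReal.ofReal ((1 / 4) ^ D) * V := by
      rw [Measure.addHaar_closedBall_mul _ _ (by norm_num) hR.le, Measure.addHaar_closedBall_center,
        hV]
    rw [← hvol, ← setLIntegral_const]
    refine (setLIntegral_mono' Metric.isClosed_closedBall.measurableSet fun u hu => ?_).trans
      (lintegral_mono_set (s := Metric.closedBall e (1 / 4 * R)) fun u hu => ?_)
    · refine ENNReal.ofReal_le_ofReal (Real.exp_le_exp.2 ?_)
      rw [Metric.mem_closedBall, dist_eq_norm] at hu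
      have h1 : ⟪z ω, u⟫ = ⟪z ω, e⟫ + ⟪z ω, u - e⟫ := by
        rw [← inner_add_right, add_sub_cancel]
      have h2 : ⟪z ω, e⟫ = 3 * R / 4 * ‖z ω‖ := by
        rw [real_inner_smul_right, real_inner_self_eq_norm_sq]
        field_simp
      have h3 := (abs_le.1 (abs_real_inner_le_norm (z ω) (u - e))).1
      have h4 := mul_le_mul_of_nonneg_left hu hzp.le
      have h5 := mul_le_mul_of_nonneg_left hω hR.le
      rw [h1, h2]
      linarith
    · rw [Metric.mem_closedBall, dist_eq_norm] at hu
      rw [mem_closedBall_zero_iff]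
      calc ‖u‖ = ‖(u - e) + e‖ := by simp
        _ ≤ _ := norm_add_le _ _
        _ ≤ 1 / 4 * R + 3 * R / 4 := add_le_add hu he.le
        _ = R := by ring
  have hm : Measurable (Function.uncurry fun (ω : Ω) (u : E) =>
      ENNReal.ofReal (Real.exp ⟪z ω, u⟫)) := by
    have : Measurable fun p : Ω × E => ⟪z p.1, p.2⟫ :=
      (hz.comp measurable_fst).inner measurable_snd
    exact (Real.measurable_exp.comp this).ennreal_ofReal
  have hmeas : MeasurableSet {ω | T ≤ ‖z ω‖} := measurableSet_le measurable_const hz.norm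
  have h1 : P {ω | T ≤ ‖z ω‖} * (ENNReal.ofReal (Real.exp (R * T / 2)) *
      (ENNReal.ofReal ((1 / 4) ^ D) * V)) ≤ ENNReal.ofReal (Real.exp (R ^ 2)) * V := by
    calc _ = ∫⁻ ω in {ω | T ≤ ‖z ω‖}, (ENNReal.ofReal (Real.exp (R * T / 2)) *
          (ENNReal.ofReal ((1 / 4) ^ D) * V)) ∂P := by rw [setLIntegral_const, mul_comm]
      _ ≤ ∫⁻ ω in {ω | T ≤ ‖z ω‖}, (∫⁻ u in Metric.closedBall (0 : E) R,
          ENNReal.ofReal (Real.exp ⟪z ω, u⟫)) ∂P := setLIntegral_mono' hmeas hlow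
      _ ≤ ∫⁻ ω, (∫⁻ u in Metric.closedBall (0 : E) R,
          ENNReal.ofReal (Real.exp ⟪z ω, u⟫)) ∂P := setLIntegral_le_lintegral _ _
      _ = ∫⁻ u in Metric.closedBall (0 : E) R, ∫⁻ ω,
          ENNReal.ofReal (Real.exp ⟪z ω, u⟫) ∂P := lintegral_lintegral_swap hm.aemeasurable
      _ ≤ ∫⁻ u in Metric.closedBall (0 : E) R, ENNReal.ofReal (Real.exp (R ^ 2)) :=
          setLIntegral_mono' Metric.isClosed_closedBall.measurableSet fun u hu =>
            hmgf u (mem_closedBall_zero_iff.1 hu)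
      _ = _ := by rw [setLIntegral_const]
  rw [← mul_assoc, ← mul_assoc, ENNReal.mul_le_mul_iff_left hV0 hVt, mul_assoc,
    ← ENNReal.ofReal_mul (by positivity)] at h1
  have hpos : 0 < Real.exp (R * T / 2) * (1 / 4) ^ D := by positivity
  rw [← ENNReal.le_div_iff_mul_le (Or.inl (by simpa using hpos)) (Or.inl ENNReal.ofReal_ne_top),
    ← ENNReal.ofReal_div_of_pos hpos] at h1
  refine h1.trans (le_of_eq ?_)
  congr 1
  rw [Real.exp_sub]
  field_simp
  rw [one_div, ← mul_pow]
  norm_num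

lemma exp_le_one_add_add_sq {x : ℝ} (hx : |x| ≤ 1) : Real.exp x ≤ 1 + x + x ^ 2 := by
  have := (abs_le.1 (Real.abs_exp_sub_one_sub_id_le hx)).2
  linarith

lemma isProbabilityMeasure_categorical {θ : EuclideanSpace ℝ (Fin d)} (hθ : θ ∈ paramSpace d) :
    IsProbabilityMeasure (categorical θ) := by
  constructor
  simp only [categorical, Measure.coe_finsetSum, Finset.sum_apply, Measure.smul_apply,
    measure_univ, smul_eq_mul, mul_one]
  rw [← ENNReal.ofReal_sum_of_nonneg fun j _ => (full_pos hθ j).le, sum_full, ENNReal.ofReal_one]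

lemma lintegral_categorical (θ : EuclideanSpace ℝ (Fin d)) (f : Fin (d + 1) → ℝ≥0∞) :
    ∫⁻ j, f j ∂categorical θ = ∑ j, ENNReal.ofReal (full θ j) * f j := by
  simp [categorical]

/-- The exponential moments of a centred weight are sub-Gaussian for weights bounded by `1`. -/
lemma lintegral_exp_categorical_le {θ : EuclideanSpace ℝ (Fin d)} (hθ : θ ∈ paramSpace d)
    {w : Fin (d + 1) → ℝ} (hw0 : ∑ j, full θ j * w j = 0) (hw1 : ∀ j, |w j| ≤ 1) :
    ∫⁻ j, ENNReal.ofReal (Real.exp (w j)) ∂categorical θ ≤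
      ENNReal.ofReal (Real.exp (∑ j, full θ j * w j ^ 2)) := by
  rw [lintegral_categorical]
  simp_rw [← ENNReal.ofReal_mul (full_pos hθ _).le]
  rw [← ENNReal.ofReal_sum_of_nonneg fun j _ => mul_nonneg (full_pos hθ j).le (Real.exp_pos _).le]
  refine ENNReal.ofReal_le_ofReal ?_
  calc _ ≤ ∑ j, full θ j * (1 + w j + w j ^ 2) := Finset.sum_le_sum fun j _ =>
        mul_le_mul_of_nonneg_left (exp_le_one_add_add_sq (hw1 j)) (full_pos hθ j).le
    _ = 1 + ∑ j, full θ j * w j ^ 2 := by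
        simp only [mul_add, mul_one, Finset.sum_add_distrib, sum_full, hw0, add_zero]
    _ ≤ _ := by rw [add_comm]; exact Real.add_one_le_exp _

lemma lintegral_exp_sum_pi {θ : EuclideanSpace ℝ (Fin d)} (hθ : θ ∈ paramSpace d) (n : ℕ)
    (w : Fin (d + 1) → ℝ) :
    ∫⁻ x, ENNReal.ofReal (Real.exp (∑ i, w (x i))) ∂(Measure.pi fun _ : Fin n => categorical θ) =
      (∫⁻ j, ENNReal.ofReal (Real.exp (w j)) ∂categorical θ) ^ n := by
  have := isProbabilityMeasure_categorical hθ
  rw [← ofReal_integral_eq_lintegral_ofReal (.of_finite) (ae_of_all _ fun _ => (Real.exp_pos _).le),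
    ← ofReal_integral_eq_lintegral_ofReal (.of_finite) (ae_of_all _ fun _ => (Real.exp_pos _).le),
    ← ENNReal.ofReal_pow (integral_nonneg fun _ => (Real.exp_pos _).le)]
  simp_rw [Real.exp_sum]
  rw [integral_fintype_prod_eq_prod (f := fun (_ : Fin n) j => Real.exp (w j))]
  simp

/-- The vector of relative frequencies of the states `1, …, d`. -/
noncomputable def freq (n : ℕ) (N : Fin (d + 1) → ℕ) : EuclideanSpace ℝ (Fin d) :=
  WithLp.toLp 2 fun j => (N j.succ : ℝ) / n

lemma full_freq {n : ℕ} (hn : 0 < n) {N : Fin (d + 1) → ℕ} (hN : ∑ j, N j = n)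
    (j : Fin (d + 1)) : full (freq n N) j = (N j : ℝ) / n := by
  have hn' : (n : ℝ) ≠ 0 := by positivity
  refine Fin.cases ?_ (fun i => ?_) j
  · simp only [full, freq, Fin.cons_zero]
    rw [← Finset.sum_div, eq_div_iff hn', sub_mul, div_mul_cancel₀ _ hn', one_mul,
      sub_eq_iff_eq_add, ← hN, Fin.sum_univ_succ]
    push_cast
    rfl
  · simp [full, freq]

lemma sum_counts {n : ℕ} (x : Fin n → Fin (d + 1)) : ∑ j, counts x j = n := by
  have := Finset.card_eq_sum_card_fiberwise (f := x) (s := Finset.univ) (t := Finset.univ)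
    (by simp)
  simpa [counts] using this.symm

lemma sum_counts_mul {n : ℕ} (x : Fin n → Fin (d + 1)) (w : Fin (d + 1) → ℝ) :
    ∑ j, (counts x j : ℝ) * w j = ∑ i, w (x i) := by
  rw [← Finset.sum_fiberwise (s := Finset.univ) (g := x) (f := fun i => w (x i))]
  refine Finset.sum_congr rfl fun j _ => ?_
  rw [Finset.sum_congr rfl (g := fun _ => w j) fun i hi => by rw [(Finset.mem_filter.1 hi).2]]
  simp [counts]

/-- In the coordinates of L, each linear functional of the deviation of the frequencies is a sum of
n independent centred variables. Smallness of s²d/(nθ_min) keeps them bounded by 1 for all the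
directions used, so they are sub-Gaussian there. -/
lemma multinomial_concentration {n : ℕ} (hn : 1 ≤ n) {θ : EuclideanSpace ℝ (Fin d)}
    (hd : 1 ≤ d) (hθ : θ ∈ paramSpace d) {s : ℝ} (hs : 16 ≤ s)
    (hc : s ^ 2 * d / (n * minProb θ) ≤ 1 / 64) :
    1 - Real.exp (-(1 / 128 * d * s ^ 2)) ≤ (multinomial n θ).real
      {N | ∑ j, N j = n ∧ wnorm (fisher θ) (freq n N - θ) ≤ s / 2 * √((d : ℝ) / n)} := by
  have := isProbabilityMeasure_categorical hθ
  have hn0 : (0 : ℝ) < n := by exact_mod_cast hn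
  have hd0 : (1 : ℝ) ≤ d := by exact_mod_cast hd
  have hm := minProb_pos hθ
  obtain ⟨L, -, hL⟩ := exists_continuousLinearEquiv hθ hn0
  have hLn : ∀ u, wnorm (fisher θ) (L u) ^ 2 = ‖u‖ ^ 2 / n := by
    intro u
    rw [wnorm_fisher, Real.sq_sqrt (fisherInner_self_nonneg hθ _), eq_div_iff hn0.ne', mul_comm,
      hL, real_inner_self_eq_norm_sq]
  set P := Measure.pi fun _ : Fin n => categorical θ with hP
  let z : (Fin n → Fin (d + 1)) → EuclideanSpace ℝ (Fin d) :=
    fun x => L.symm (freq n (counts x) - θ)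
  have hzm : Measurable z := measurable_of_finite z
  set T := s * √d / 2 with hT
  have hTp : 0 < T := by positivity
  have hmgf : ∀ u : EuclideanSpace ℝ (Fin d), ‖u‖ ≤ T / 4 →
      ∫⁻ x, ENNReal.ofReal (Real.exp ⟪z x, u⟫) ∂P ≤
        ENNReal.ofReal (Real.exp ((T / 4) ^ 2)) := by
    intro u hu
    -- The score in the direction Lu: it has mean zero because the coordinates of a tangent vector
    -- sum to zero, and its variance is ‖u‖²/n.
    let w : Fin (d + 1) → ℝ := fun j => ext (L u) j / full θ j
    have hw0 : ∑ j, full θ j * w j = 0 := by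
      rw [← sum_ext (L u)]
      exact Finset.sum_congr rfl fun j _ => mul_div_cancel₀ _ (full_pos hθ j).ne'
    have hw2 : ∑ j, full θ j * w j ^ 2 = ‖u‖ ^ 2 / n := by
      rw [← hLn, wnorm_fisher_sq hθ]
      refine Finset.sum_congr rfl fun j _ => ?_
      have := (full_pos hθ j).ne'
      simp only [w]
      field_simp
    have hw1 : ∀ j, |w j| ≤ 1 := by
      intro j
      rw [abs_div, abs_of_pos (full_pos hθ j), div_le_one (full_pos hθ j)]
      refine (abs_ext_le hθ _ j).trans (mul_le_of_le_one_right (full_pos hθ j).le ?_)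
      rw [div_le_one (Real.sqrt_pos.2 hm)]
      apply Real.le_sqrt_of_sq_le
      rw [hLn, div_le_iff₀ hn0]
      have h1 : ‖u‖ ^ 2 ≤ (T / 4) ^ 2 := by gcongr
      have h2 : T ^ 2 = s ^ 2 * d / 4 := by
        rw [hT, div_pow, mul_pow, Real.sq_sqrt (by positivity)]; norm_num
      rw [div_le_iff₀ (by positivity)] at hc
      have h3 : 0 < (n : ℝ) * minProb θ := by positivity
      nlinarith
    have hz : ∀ x, ⟪z x, u⟫ = ∑ i, w (x i) := by
      intro x
      rw [← hL]
      simp only [z, ContinuousLinearEquiv.apply_symm_apply]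
      rw [← sum_counts_mul, fisherInner, Finset.mul_sum]
      have : ∀ j, (n : ℝ) * (ext (freq n (counts x) - θ) j * ext (L u) j / full θ j) =
          (counts x j : ℝ) * w j - n * (full θ j * w j) := by
        intro j
        rw [ext_sub, full_freq hn (sum_counts x)]
        have := (full_pos hθ j).ne'
        simp only [w]
        field_simp
      simp_rw [this]
      rw [Finset.sum_sub_distrib, ← Finset.mul_sum, hw0, mul_zero, sub_zero]
    simp_rw [hz]
    rw [hP, lintegral_exp_sum_pi hθ]
    refine (pow_le_pow_left₀ (by positivity) (lintegral_exp_categorical_le hθ hw0 hw1) n).trans ?_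
    rw [← ENNReal.ofReal_pow (by positivity), hw2, ← Real.exp_nat_mul,
      mul_div_cancel₀ _ hn0.ne']
    gcongr
  have hbad := measure_norm_ge_le hzm (R := T / 4) (by positivity) hTp hmgf
  have hT2 : T ^ 2 = s ^ 2 * d / 4 := by
    rw [hT, div_pow, mul_pow, Real.sq_sqrt (by positivity)]; norm_num
  -- The exponent is T²/16 - T²/8 = -ds²/64. Half of it absorbs 4^d ≤ e^{2d}, since s² ≥ 256.
  have hexp : (4 : ℝ) ^ Module.finrank ℝ (EuclideanSpace ℝ (Fin d)) *
      Real.exp ((T / 4) ^ 2 - T / 4 * T / 2) ≤ Real.exp (-(1 / 128 * d * s ^ 2)) := by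
    have h4 : (4 : ℝ) ≤ Real.exp 2 := by
      have := Real.add_one_le_exp (1 : ℝ)
      calc (4 : ℝ) = 2 * 2 := by norm_num
        _ ≤ Real.exp 1 * Real.exp 1 := by gcongr <;> linarith
        _ = Real.exp 2 := by rw [← Real.exp_add]; norm_num
    rw [finrank_euclideanSpace_fin]
    calc _ ≤ Real.exp 2 ^ d * Real.exp ((T / 4) ^ 2 - T / 4 * T / 2) := by gcongr
      _ = Real.exp (d * 2 + ((T / 4) ^ 2 - T / 4 * T / 2)) := by
          rw [← Real.exp_nat_mul, Real.exp_add]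
      _ ≤ _ := by
          refine Real.exp_le_exp.2 ?_
          have : (256 : ℝ) ≤ s ^ 2 := by nlinarith
          nlinarith
  have hgood : {x : Fin n → Fin (d + 1) | ‖z x‖ < T} ⊆ counts ⁻¹'
      {N | ∑ j, N j = n ∧ wnorm (fisher θ) (freq n N - θ) ≤ s / 2 * √((d : ℝ) / n)} := by
    intro x hx
    refine ⟨sum_counts x, ?_⟩
    have h1 := hLn (z x)
    simp only [z, ContinuousLinearEquiv.apply_symm_apply] at h1
    apply abs_le_of_sq_le_sq' _ (by positivity) |>.2
    rw [h1, mul_pow, Real.sq_sqrt (by positivity), div_pow, mul_div_assoc']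
    have h3 : ‖z x‖ ^ 2 ≤ T ^ 2 := by
      have : ‖z x‖ ≤ T := le_of_lt hx
      gcongr
    gcongr
    rw [hT2] at h3
    linarith
  rw [multinomial, map_measureReal_apply (measurable_of_finite _) (Set.to_countable _).measurableSet]
  refine le_trans ?_ (measureReal_mono hgood)
  have hc : {x : Fin n → Fin (d + 1) | ‖z x‖ < T} = {x | T ≤ ‖z x‖}ᶜ := by
    ext x; simp
  rw [hc, probReal_compl_eq_one_sub (Set.toFinite _).measurableSet]
  have : P.real {x | T ≤ ‖z x‖} ≤ Real.exp (-(1 / 128 * d * s ^ 2)) := by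
    refine ENNReal.toReal_le_of_le_ofReal (Real.exp_pos _).le (hbad.trans ?_)
    exact ENNReal.ofReal_le_ofReal hexp
  linarith
end Concentration

/-! ### The likelihood as a Kullback–Leibler divergence -/

section Likelihood
open scoped RealInnerProductSpace ENNReal
variable {d : ℕ}

/-- The Kullback–Leibler divergence of two vectors of probabilities. -/
noncomputable def gap (p θ : EuclideanSpace ℝ (Fin d)) : ℝ :=
  ∑ j, full p j * (Real.log (full p j) - Real.log (full θ j))

/-- Cross-entropy is entropy plus divergence. From here on the data enter only through the
frequencies. -/
lemma negLogLik_sub {n : ℕ} (hn : 0 < n) {N : Fin (d + 1) → ℕ} (hN : ∑ j, N j = n)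
    (θ : EuclideanSpace ℝ (Fin d)) :
    negLogLik n N θ = negLogLik n N (freq n N) + gap (freq n N) θ := by
  simp only [negLogLik, gap, full_freq hn hN, mul_sub, Finset.sum_sub_distrib]
  ring

/-- Since tangent coordinates sum to zero, linear terms can be added for free; each summand then
becomes y - log(1 + y) ≥ 0. -/
lemma gap_eq {p θ : EuclideanSpace ℝ (Fin d)} (hp : p ∈ paramSpace d) (hθ : θ ∈ paramSpace d) :
    gap p θ = ∑ j, full p j *
      (ext (θ - p) j / full p j - Real.log (1 + ext (θ - p) j / full p j)) := by
  have h : ∀ j, full p j *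
      (ext (θ - p) j / full p j - Real.log (1 + ext (θ - p) j / full p j)) =
      full p j * (Real.log (full p j) - Real.log (full θ j)) + ext (θ - p) j := by
    intro j
    have h1 := full_pos hp j
    have h2 := full_pos hθ j
    have : 1 + ext (θ - p) j / full p j = full θ j / full p j := by
      rw [ext_sub]; field_simp; ring
    rw [this, Real.log_div h2.ne' h1.ne', mul_sub, mul_div_cancel₀ _ h1.ne']
    ring
  simp_rw [h]
  rw [Finset.sum_add_distrib, sum_ext, add_zero, gap]

lemma one_add_ext_div_pos {p θ : EuclideanSpace ℝ (Fin d)} (hp : p ∈ paramSpace d)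
    (hθ : θ ∈ paramSpace d) (j : Fin (d + 1)) : 0 < 1 + ext (θ - p) j / full p j := by
  have h1 := full_pos hp j
  have : 1 + ext (θ - p) j / full p j = full θ j / full p j := by
    rw [ext_sub]; field_simp; ring
  rw [this]
  exact div_pos (full_pos hθ j) h1

lemma gap_nonneg {p θ : EuclideanSpace ℝ (Fin d)} (hp : p ∈ paramSpace d)
    (hθ : θ ∈ paramSpace d) : 0 ≤ gap p θ := by
  rw [gap_eq hp hθ]
  refine Finset.sum_nonneg fun j _ => mul_nonneg (full_pos hp j).le ?_
  have := Real.log_le_sub_one_of_pos (one_add_ext_div_pos hp hθ j)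
  linarith

lemma eq_of_gap_eq_zero {p θ : EuclideanSpace ℝ (Fin d)} (hp : p ∈ paramSpace d)
    (hθ : θ ∈ paramSpace d) (h : gap p θ = 0) : θ = p := by
  rw [gap_eq hp hθ, Finset.sum_eq_zero_iff_of_nonneg] at h
  · ext i
    have h1 := h i.succ (Finset.mem_univ _)
    have hpi := full_pos hp i.succ
    rw [mul_eq_zero, or_iff_right hpi.ne'] at h1
    by_contra hne
    have hy : 1 + ext (θ - p) i.succ / full p i.succ ≠ 1 := by
      have : ext (θ - p) i.succ ≠ 0 := by
        simpa [ext, sub_eq_zero] using hne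
      simp [this, hpi.ne']
    have := Real.log_lt_sub_one_of_pos (one_add_ext_div_pos hp hθ i.succ) hy
    linarith
  · intro j _
    have := Real.log_le_sub_one_of_pos (one_add_ext_div_pos hp hθ j)
    exact mul_nonneg (full_pos hp j).le (by linarith)

lemma isMLE_freq {n : ℕ} (hn : 0 < n) {N : Fin (d + 1) → ℕ} (hN : ∑ j, N j = n)
    (hp : freq n N ∈ paramSpace d) :
    IsMLE n N (freq n N) ∧ ∀ θ, IsMLE n N θ → θ = freq n N := by
  refine ⟨⟨hp, fun θ hθ => ?_⟩, fun θ hθ => ?_⟩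
  · have := negLogLik_sub hn hN θ
    have h2 := gap_nonneg hp hθ
    change negLogLik n N _ ≤ negLogLik n N _
    linarith
  · refine eq_of_gap_eq_zero hp hθ.1 (le_antisymm ?_ (gap_nonneg hp hθ.1))
    have h1 := negLogLik_sub hn hN θ
    have h2 : negLogLik n N θ ≤ negLogLik n N (freq n N) := hθ.2 hp
    linarith

lemma sub_log_one_add_le {y : ℝ} (hy : |y| ≤ 1 / 2) : y - Real.log (1 + y) ≤ 2 * y ^ 2 := by
  have h := abs_le.1 hy
  have h1 : 0 < 1 + y := by linarith
  have h2 := Real.one_sub_inv_le_log_of_pos h1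
  have h3 : y - (1 - (1 + y)⁻¹) ≤ 2 * y ^ 2 := by
    have : y - (1 - (1 + y)⁻¹) = y ^ 2 / (1 + y) := by field_simp; ring
    rw [this, div_le_iff₀ h1]
    nlinarith [sq_nonneg y]
  linarith

/-- With r = √(1 + y), the inequality log r ≤ r - 1 yields y - log(1 + y) ≥ (r - 1)², while y² = (r
- 1)²(r + 1)² and (r + 1)² ≤ 6. -/
lemma le_sub_log_one_add {y : ℝ} (hy : |y| ≤ 1 / 2) : y ^ 2 / 6 ≤ y - Real.log (1 + y) := by
  have h := abs_le.1 hy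
  have h1 : 0 < 1 + y := by linarith
  have h2 := Real.log_le_sub_one_of_pos (Real.sqrt_pos.2 h1)
  rw [Real.log_sqrt h1.le] at h2
  have h3 := Real.sq_sqrt h1.le
  have h4 : √(1 + y) ≤ 5 / 4 := by
    rw [Real.sqrt_le_left (by norm_num)]; norm_num; linarith
  have h5 := Real.sqrt_nonneg (1 + y)
  set r := √(1 + y)
  have hy' : y = r ^ 2 - 1 := by linarith
  have h6 : y ^ 2 / 6 ≤ (r - 1) ^ 2 := by
    rw [hy']
    have : (r ^ 2 - 1) ^ 2 = (r - 1) ^ 2 * (r + 1) ^ 2 := by ring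
    rw [this]
    have h7 : (r + 1) ^ 2 ≤ 6 := by nlinarith
    have := mul_le_mul_of_nonneg_left h7 (sq_nonneg (r - 1))
    linarith
  nlinarith

lemma gap_bounds {p u : EuclideanSpace ℝ (Fin d)} (hp : p ∈ paramSpace d)
    (hu : ∀ j, |ext u j| ≤ full p j / 2) :
    (∑ j, ext u j ^ 2 / full p j) / 6 ≤ gap p (p + u) ∧
      gap p (p + u) ≤ 2 * ∑ j, ext u j ^ 2 / full p j := by
  have hmem : p + u ∈ paramSpace d := by
    refine mem_paramSpace_iff.2 fun j => ?_
    have := (abs_le.1 (hu j)).1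
    have := full_pos hp j
    rw [full_add]
    linarith
  have hy : ∀ j, |ext u j / full p j| ≤ 1 / 2 := by
    intro j
    rw [abs_div, abs_of_pos (full_pos hp j), div_le_iff₀ (full_pos hp j)]
    linarith [hu j]
  rw [gap_eq hp hmem, add_sub_cancel_left, Finset.sum_div, Finset.mul_sum]
  constructor <;> refine Finset.sum_le_sum fun j _ => ?_
  · calc _ = full p j * ((ext u j / full p j) ^ 2 / 6) := by
          have := (full_pos hp j).ne'
          field_simp
      _ ≤ _ := mul_le_mul_of_nonneg_left (le_sub_log_one_add (hy j)) (full_pos hp j).le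
  · calc _ ≤ full p j * (2 * (ext u j / full p j) ^ 2) :=
          mul_le_mul_of_nonneg_left (sub_log_one_add_le (hy j)) (full_pos hp j).le
      _ = _ := by
          have := (full_pos hp j).ne'
          field_simp

/-- The divergence is convex in its second argument and vanishes at p. -/
lemma gap_smul_le {p u : EuclideanSpace ℝ (Fin d)} (hp : p ∈ paramSpace d)
    (hu : p + u ∈ paramSpace d) {t : ℝ} (ht : 0 ≤ t) (ht1 : t ≤ 1) :
    gap p (p + t • u) ≤ t * gap p (p + u) := by
  unfold gap
  rw [Finset.mul_sum]
  refine Finset.sum_le_sum fun j _ => ?_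
  have h1 := full_pos hp j
  have h2 := full_pos hu j
  have := strictConcaveOn_log_Ioi.concaveOn.2 h1 h2 (sub_nonneg.2 ht1) ht (by ring)
  have e : full (p + t • u) j = (1 - t) • full p j + t • full (p + u) j := by
    rw [full_add, full_add, ext_smul]; simp only [smul_eq_mul]; ring
  rw [e]
  simp only [smul_eq_mul] at this ⊢
  rw [mul_left_comm]
  refine mul_le_mul_of_nonneg_left ?_ h1.le
  linarith

/-- The coordinates of the tangent vector as continuous linear forms. -/
noncomputable def extCLM (j : Fin (d + 1)) : EuclideanSpace ℝ (Fin d) →L[ℝ] ℝ :=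
  LinearMap.toContinuousLinearMap
    { toFun := fun u => ext u j
      map_add' := fun u v => ext_add u v j
      map_smul' := fun c u => ext_smul c u j }

@[simp] lemma extCLM_apply (j : Fin (d + 1)) (u : EuclideanSpace ℝ (Fin d)) :
    extCLM j u = ext u j := rfl

lemma full_eq (θ : EuclideanSpace ℝ (Fin d)) (j : Fin (d + 1)) :
    full θ j = full 0 j + extCLM j θ := by
  rw [extCLM_apply, ← full_add, zero_add]

lemma continuous_full (j : Fin (d + 1)) :
    Continuous fun θ : EuclideanSpace ℝ (Fin d) => full θ j := by
  rw [funext fun θ => full_eq θ j]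
  fun_prop

lemma isOpen_paramSpace : IsOpen (paramSpace d) := by
  have : paramSpace d = ⋂ j, {θ | 0 < full θ j} := by
    ext θ; simp [mem_paramSpace_iff]
  rw [this]
  exact isOpen_iInter_of_finite fun j => isOpen_lt continuous_const (continuous_full j)

lemma hasFDerivAt_gap (p : EuclideanSpace ℝ (Fin d)) {θ : EuclideanSpace ℝ (Fin d)}
    (hθ : θ ∈ paramSpace d) :
    HasFDerivAt (gap p) (-∑ j, (full p j / full θ j) • extCLM j) θ := by
  unfold gap
  rw [← Finset.sum_neg_distrib]
  refine HasFDerivAt.fun_sum fun j _ => ?_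
  have h1 : HasFDerivAt (fun θ : EuclideanSpace ℝ (Fin d) => full θ j) (extCLM j) θ := by
    rw [funext fun θ => full_eq θ j]
    exact (extCLM j).hasFDerivAt.const_add _
  have h2 := ((h1.log (full_pos hθ j).ne').const_sub (Real.log (full p j))).const_mul (full p j)
  exact h2.congr_fderiv (by rw [smul_neg, smul_smul, div_eq_mul_inv])
end Likelihood

/-! ### The likelihood near the frequencies -/

section Local
open scoped RealInnerProductSpace ENNReal
variable {d : ℕ}

/-- The local situation around a point `p` which is close to `θs`: a linear parametrization in which
the metric of the Fisher information at `θs`, times `n`, is the Euclidean one. -/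
structure IsLocalFrame (n : ℕ) (s : ℝ) (θs p : EuclideanSpace ℝ (Fin d))
    (L : EuclideanSpace ℝ (Fin d) ≃L[ℝ] EuclideanSpace ℝ (Fin d)) : Prop where
  mem : θs ∈ paramSpace d
  dim_pos : 1 ≤ d
  n_pos : 1 ≤ n
  s_pos : 1 ≤ s
  inner_eq : ∀ x y, n * fisherInner θs (L x) (L y) = ⟪x, y⟫
  small : s ^ 2 * d / (n * minProb θs) ≤ 1 / 64
  close : wnorm (fisher θs) (p - θs) ≤ s / 2 * √((d : ℝ) / n)

namespace IsLocalFrame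
variable {n : ℕ} {s : ℝ} {θs p : EuclideanSpace ℝ (Fin d)}
  {L : EuclideanSpace ℝ (Fin d) ≃L[ℝ] EuclideanSpace ℝ (Fin d)}

lemma wnorm_eq (h : IsLocalFrame n s θs p L) (x : EuclideanSpace ℝ (Fin d)) :
    wnorm (fisher θs) (L x) = ‖x‖ / √n := by
  have hn : (0 : ℝ) < n := by exact_mod_cast h.n_pos
  have : fisherInner θs (L x) (L x) = ‖x‖ ^ 2 / n := by
    rw [eq_div_iff hn.ne', mul_comm, h.inner_eq, real_inner_self_eq_norm_sq]
  rw [wnorm_fisher, this, Real.sqrt_div (sq_nonneg _), Real.sqrt_sq (norm_nonneg _)]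

lemma norm_close (h : IsLocalFrame n s θs p L) : ‖L.symm (p - θs)‖ ≤ s / 2 * √d := by
  have hn : (0 : ℝ) < √n := Real.sqrt_pos.2 (by exact_mod_cast h.n_pos)
  have := h.close
  rw [← L.apply_symm_apply (p - θs), h.wnorm_eq, Real.sqrt_div (by positivity), div_le_iff₀ hn,
    mul_assoc, div_mul_cancel₀ _ hn.ne'] at this
  exact this

/-- The quantity η = s√d/√(nθ_min) bounds the relative change of each probability over a
displacement of norm s√d. -/
lemma abs_ext_sub_le (h : IsLocalFrame n s θs p L) {x : EuclideanSpace ℝ (Fin d)} {a : ℝ}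
    (hx : ‖x‖ ≤ a * (s * √d)) (j : Fin (d + 1)) :
    |ext (L x) j| ≤ full θs j * (a * (s * √d / √(n * minProb θs))) := by
  refine (abs_ext_le h.mem _ j).trans (mul_le_mul_of_nonneg_left ?_ (full_pos h.mem j).le)
  rw [h.wnorm_eq, div_div, ← Real.sqrt_mul (by positivity), mul_div_assoc']
  gcongr

lemma small' (h : IsLocalFrame n s θs p L) : s * √d / √(n * minProb θs) ≤ 1 / 8 := by
  have hm := minProb_pos h.mem
  have hn : (0 : ℝ) < n := by exact_mod_cast h.n_pos
  have hs := h.s_pos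
  refine abs_le_of_sq_le_sq' ?_ (by norm_num) |>.2
  rw [div_pow, mul_pow, Real.sq_sqrt (by positivity), Real.sq_sqrt (by positivity)]
  exact h.small.trans (by norm_num)

lemma small_nonneg (h : IsLocalFrame n s θs p L) : 0 ≤ s * √d / √(n * minProb θs) := by
  have hs := h.s_pos
  positivity

lemma abs_full_sub_le (h : IsLocalFrame n s θs p L) (j : Fin (d + 1)) :
    |full p j - full θs j| ≤ full θs j / 16 := by
  have h1 := h.abs_ext_sub_le (x := L.symm (p - θs)) (a := 1 / 2)
    (h.norm_close.trans (by linarith)) j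
  rw [L.apply_symm_apply, ext_sub] at h1
  have := mul_le_mul_of_nonneg_left h.small' (full_pos h.mem j).le
  linarith

lemma center_mem (h : IsLocalFrame n s θs p L) : p ∈ paramSpace d := by
  refine mem_paramSpace_iff.2 fun j => ?_
  have := (abs_le.1 (h.abs_full_sub_le j)).1
  have := full_pos h.mem j
  linarith

lemma sqrt_two_le : √2 ≤ 3 / 2 := by
  rw [Real.sqrt_le_left (by norm_num)]; norm_num

lemma abs_ext_le_of_norm_le (h : IsLocalFrame n s θs p L) {x : EuclideanSpace ℝ (Fin d)}
    (hx : ‖x‖ ≤ √2 * (s * √d)) (j : Fin (d + 1)) : |ext (L x) j| ≤ full θs j * (3 / 16) := by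
  have hs := h.s_pos
  have h1 := h.abs_ext_sub_le (a := 3 / 2) (hx.trans (by gcongr; exact sqrt_two_le)) j
  refine h1.trans (mul_le_mul_of_nonneg_left ?_ (full_pos h.mem j).le)
  linarith [h.small']

/-- The displacement of p costs s/2 and the ball enlarged by rotation costs √2 s; together they are
below 2s, the radius at which the prior is controlled. -/
lemma mem_nbhd (h : IsLocalFrame n s θs p L) {x : EuclideanSpace ℝ (Fin d)}
    (hx : ‖x‖ ≤ √2 * (s * √d)) : p + L x ∈ nbhd n θs (2 * s) := by
  have hn : (0 : ℝ) < √n := Real.sqrt_pos.2 (by exact_mod_cast h.n_pos)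
  have hs := h.s_pos
  have e : p + L x - θs = L (L.symm (p - θs) + x) := by
    rw [map_add, L.apply_symm_apply]; abel
  change wnorm (fisher θs) (p + L x - θs) ≤ 2 * s * √((d : ℝ) / n)
  rw [e, h.wnorm_eq, Real.sqrt_div (by positivity), mul_div_assoc']
  gcongr
  have h0 : 0 ≤ s * √d := by positivity
  calc _ ≤ ‖L.symm (p - θs)‖ + ‖x‖ := norm_add_le _ _
    _ ≤ s / 2 * √d + √2 * (s * √d) := add_le_add h.norm_close hx
    _ ≤ s / 2 * √d + 3 / 2 * (s * √d) := by gcongr; exact sqrt_two_le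
    _ = _ := by ring

lemma abs_full_add_sub_le (h : IsLocalFrame n s θs p L) {x : EuclideanSpace ℝ (Fin d)}
    (hx : ‖x‖ ≤ √2 * (s * √d)) (j : Fin (d + 1)) :
    |full (p + L x) j - full θs j| ≤
      full θs j * (2 * (s * √d / √(n * minProb θs))) := by
  have hs := h.s_pos
  have h0 : 0 ≤ s * √d := by positivity
  have e : full (p + L x) j - full θs j = ext (L (L.symm (p - θs) + x)) j := by
    rw [← ext_sub, map_add, L.apply_symm_apply]
    congr 1
    abel
  rw [e]
  refine h.abs_ext_sub_le ?_ j
  calc _ ≤ ‖L.symm (p - θs)‖ + ‖x‖ := norm_add_le _ _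
    _ ≤ s / 2 * √d + √2 * (s * √d) := add_le_add h.norm_close hx
    _ ≤ s / 2 * √d + 3 / 2 * (s * √d) := by gcongr; exact sqrt_two_le
    _ = _ := by ring

lemma three_quarters_le (h : IsLocalFrame n s θs p L) {x : EuclideanSpace ℝ (Fin d)}
    (hx : ‖x‖ ≤ √2 * (s * √d)) (j : Fin (d + 1)) :
    3 / 4 * full θs j ≤ full (p + L x) j := by
  have h1 := (abs_le.1 (h.abs_full_add_sub_le hx j)).1
  have h2 := mul_le_mul_of_nonneg_left h.small' (full_pos h.mem j).le
  linarith

lemma add_mem (h : IsLocalFrame n s θs p L) {x : EuclideanSpace ℝ (Fin d)}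
    (hx : ‖x‖ ≤ √2 * (s * √d)) : p + L x ∈ paramSpace d :=
  mem_paramSpace_iff.2 fun j =>
    lt_of_lt_of_le (mul_pos (by norm_num) (full_pos h.mem j)) (h.three_quarters_le hx j)

lemma gap_bounds (h : IsLocalFrame n s θs p L) {x : EuclideanSpace ℝ (Fin d)}
    (hx : ‖x‖ ≤ √2 * (s * √d)) :
    ‖x‖ ^ 2 / 12 ≤ n * gap p (p + L x) ∧ n * gap p (p + L x) ≤ 4 * ‖x‖ ^ 2 := by
  have hn : (0 : ℝ) < n := by exact_mod_cast h.n_pos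
  have hp := fun j => abs_le.1 (h.abs_full_sub_le j)
  have hθ := full_pos h.mem
  have h1 := MultinomialBvM.gap_bounds h.center_mem (u := L x) fun j => by
    have := h.abs_ext_le_of_norm_le hx j
    linarith [(hp j).1, hθ j]
  have e : ‖x‖ ^ 2 = n * ∑ j, ext (L x) j ^ 2 / full θs j := by
    rw [← real_inner_self_eq_norm_sq, ← h.inner_eq, fisherInner]
    simp_rw [sq]
  -- The weights 1/p_j and 1/θ*_j agree up to a factor 2, which turns the constants 1/6 and 2 into
  -- 1/12 and 4.
  have l1 : (∑ j, ext (L x) j ^ 2 / full θs j) / 2 ≤ ∑ j, ext (L x) j ^ 2 / full p j := by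
    rw [Finset.sum_div]
    refine Finset.sum_le_sum fun j _ => ?_
    rw [div_div]
    refine div_le_div_of_nonneg_left (sq_nonneg _) (full_pos h.center_mem j) ?_
    linarith [(hp j).2, hθ j]
  have l2 : ∑ j, ext (L x) j ^ 2 / full p j ≤ 2 * ∑ j, ext (L x) j ^ 2 / full θs j := by
    rw [Finset.mul_sum]
    refine Finset.sum_le_sum fun j _ => ?_
    rw [mul_div_assoc', div_le_div_iff₀ (full_pos h.center_mem j) (hθ j)]
    have : full θs j ≤ 2 * full p j := by linarith [(hp j).1, hθ j]
    nlinarith [sq_nonneg (ext (L x) j)]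
  rw [e]
  constructor <;> nlinarith [h1.1, h1.2]

/-- Outside the ball the quadratic bound may fail, since relative changes are no longer small.
Convexity carries the value R²/12 at radius R = s√d outwards along rays, at least linearly. -/
lemma linear_growth (h : IsLocalFrame n s θs p L) {x : EuclideanSpace ℝ (Fin d)}
    (hx : s * √d ≤ ‖x‖) (hmem : p + L x ∈ paramSpace d) :
    s * √d * ‖x‖ / 12 ≤ n * gap p (p + L x) := by
  have hn : (0 : ℝ) < n := by exact_mod_cast h.n_pos
  have hd : (0 : ℝ) < d := by exact_mod_cast h.dim_pos
  have hs := h.s_pos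
  have hR : 0 < s * √d := by positivity
  set R := s * √d with hRdef
  have hx0 : 0 < ‖x‖ := hR.trans_le hx
  set t := R / ‖x‖ with ht
  have ht0 : 0 < t := by positivity
  have hnorm : ‖t • x‖ = R := by
    rw [norm_smul, Real.norm_of_nonneg ht0.le, ht, div_mul_cancel₀ _ hx0.ne']
  have h1 := gap_smul_le h.center_mem hmem ht0.le ((div_le_one hx0).2 hx)
  have h2 := (h.gap_bounds (x := t • x) (by
    rw [hnorm, ← hRdef]
    have : (1 : ℝ) ≤ √2 := Real.one_le_sqrt.2 (by norm_num)
    nlinarith)).1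
  rw [map_smul, hnorm] at h2
  have h3 : R ^ 2 / 12 ≤ t * (n * gap p (p + L x)) := by
    have := mul_le_mul_of_nonneg_left h1 hn.le
    linarith
  rw [ht, div_mul_eq_mul_div, le_div_iff₀ hx0] at h3
  have h4 : R * (R * ‖x‖ / 12) ≤ R * (n * gap p (p + L x)) := by linarith
  exact le_of_mul_le_mul_left h4 hR

/-- The derivative of the discrepancy of the log likelihood and its quadratic approximation. -/
lemma abs_fderiv_le (h : IsLocalFrame n s θs p L) {x : EuclideanSpace ℝ (Fin d)}
    (hx : ‖x‖ ≤ √2 * (s * √d)) (v : EuclideanSpace ℝ (Fin d)) :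
    |n * (-∑ j, (full p j / full (p + L x) j) • extCLM j) (L v) - ⟪x, v⟫| ≤
      4 * (s * √d / √(n * minProb θs)) * ‖x‖ * ‖v‖ := by
  have hn : (0 : ℝ) < n := by exact_mod_cast h.n_pos
  set η := s * √d / √(n * minProb θs)
  have hη := h.small'
  have hη0 := h.small_nonneg
  have hθ := full_pos h.mem
  have hq := full_pos (h.add_mem hx)
  -- Adding ∑ (Lv)_j = 0 turns the derivative into the Fisher form at the point q = p + Lx, so only
  -- 1/q_j and 1/θ*_j have to be compared and no Taylor remainder appears.
  have e1 : (-∑ j, (full p j / full (p + L x) j) • extCLM j) (L v) =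
      ∑ j, ext (L x) j * ext (L v) j / full (p + L x) j := by
    have : ∀ j, ext (L x) j * ext (L v) j / full (p + L x) j =
        ext (L v) j - full p j / full (p + L x) j * ext (L v) j := by
      intro j
      have hqj := (hq j).ne'
      have : ext (L x) j = full (p + L x) j - full p j := by rw [full_add]; ring
      rw [this]
      field_simp
    simp_rw [this]
    rw [Finset.sum_sub_distrib, sum_ext]
    simp
  rw [e1, ← h.inner_eq, fisherInner, ← mul_sub, ← Finset.sum_sub_distrib, abs_mul, abs_of_pos hn]
  -- Here |q_j - θ*_j| ≤ 2η θ*_j and θ*_j ≤ (4/3) q_j, which is below 4η q_j. Cauchy–Schwarz then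
  -- sums over the states.
  have e2 : ∀ j, |ext (L x) j * ext (L v) j / full (p + L x) j -
      ext (L x) j * ext (L v) j / full θs j| ≤
      4 * η * (|ext (L x) j| / √(full θs j) * (|ext (L v) j| / √(full θs j))) := by
    intro j
    have hqj := hq j
    have hθj := hθ j
    have : ext (L x) j * ext (L v) j / full (p + L x) j - ext (L x) j * ext (L v) j / full θs j =
      -((ext (L x) j * ext (L v) j) * (full (p + L x) j - full θs j) /
        (full (p + L x) j * full θs j)) := by
      field_simp
      ring
    rw [this, abs_neg, abs_div, abs_mul, abs_mul, abs_of_pos (mul_pos hqj hθj), div_mul_div_comm,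
      Real.mul_self_sqrt hθj.le, mul_div_assoc', div_le_div_iff₀ (mul_pos hqj hθj) hθj]
    have h1 := h.abs_full_add_sub_le hx j
    have h2 := h.three_quarters_le hx j
    have h3 : |full (p + L x) j - full θs j| ≤ 4 * η * full (p + L x) j := by
      refine h1.trans ?_
      have := mul_le_mul_of_nonneg_left h2 hη0
      have h4 : 0 ≤ η * full θs j := mul_nonneg hη0 hθj.le
      change full θs j * (2 * η) ≤ _
      linarith
    have h5 : 0 ≤ |ext (L x) j| * |ext (L v) j| * full θs j := by positivity
    have := mul_le_mul_of_nonneg_left h3 h5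
    linarith
  have e3 : ∀ y, ∑ j, (|ext (L y) j| / √(full θs j)) ^ 2 = ‖y‖ ^ 2 / n := by
    intro y
    rw [eq_div_iff hn.ne', mul_comm, ← real_inner_self_eq_norm_sq, ← h.inner_eq, fisherInner]
    congr 1
    refine Finset.sum_congr rfl fun j _ => ?_
    rw [div_pow, sq_abs, Real.sq_sqrt (hθ j).le, sq]
  have e4 := Real.sum_mul_le_sqrt_mul_sqrt Finset.univ
    (fun j => |ext (L x) j| / √(full θs j)) (fun j => |ext (L v) j| / √(full θs j))
  rw [e3, e3, Real.sqrt_div (sq_nonneg _), Real.sqrt_div (sq_nonneg _),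
    Real.sqrt_sq (norm_nonneg _), Real.sqrt_sq (norm_nonneg _), div_mul_div_comm,
    Real.mul_self_sqrt hn.le] at e4
  calc _ ≤ n * ∑ j, 4 * η * (|ext (L x) j| / √(full θs j) * (|ext (L v) j| / √(full θs j))) :=
        mul_le_mul_of_nonneg_left
          ((Finset.abs_sum_le_sum_abs _ _).trans (Finset.sum_le_sum fun j _ => e2 j)) hn.le
    _ ≤ n * (4 * η * (‖x‖ * ‖v‖ / n)) := by
        rw [← Finset.mul_sum]
        gcongr
    _ = _ := by field_simp

end IsLocalFrame
end Local

/-! ### The prior and the gradient of the discrepancy -/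

section Prior
open scoped RealInnerProductSpace ENNReal
variable {d n : ℕ} {s : ℝ} {θs p : EuclideanSpace ℝ (Fin d)}
  {L : EuclideanSpace ℝ (Fin d) ≃L[ℝ] EuclideanSpace ℝ (Fin d)}
  {prior : EuclideanSpace ℝ (Fin d) → ℝ}

/-- The prior is positive with a continuous gradient near `θs`, and the logarithmic gradient has
dual norm at most `D`. -/
structure IsRegularPrior (n : ℕ) (θs : EuclideanSpace ℝ (Fin d))
    (prior : EuclideanSpace ℝ (Fin d) → ℝ) (r D : ℝ) : Prop where
  bound_nonneg : 0 ≤ D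
  pos : ∀ θ ∈ nbhd n θs r, 0 < prior θ
  diff : ∀ θ ∈ nbhd n θs r, DifferentiableAt ℝ prior θ
  cont : ContinuousOn (gradient prior) (nbhd n θs r)
  bound : ∀ θ ∈ nbhd n θs r, ∀ u, wnorm (fisher θs) u = 1 →
    ⟪gradient (fun η => Real.log (prior η)) θ, u⟫ ≤ D

lemma isRegularPrior_of_delta01_ne_top {r : ℝ} (h : delta01 n θs prior r ≠ ⊤) :
    IsRegularPrior n θs prior r (delta01 n θs prior r).toReal := by
  by_cases hc : (∀ θ ∈ nbhd n θs r, 0 < prior θ ∧ DifferentiableAt ℝ prior θ) ∧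
      ContinuousOn (gradient prior) (nbhd n θs r)
  · refine ⟨ENNReal.toReal_nonneg, fun θ hθ => (hc.1 θ hθ).1, fun θ hθ => (hc.1 θ hθ).2, hc.2,
      fun θ hθ u hu => ?_⟩
    refine (ENNReal.ofReal_le_iff_le_toReal h).1 ?_
    rw [delta01, if_pos hc]
    refine le_trans ?_ (le_iSup₂ (f := fun θ (_ : θ ∈ nbhd n θs r) =>
      wopNorm (fisher θs) (gradient (fun η => Real.log (prior η)) θ)) θ hθ)
    exact le_iSup₂ (f := fun u (_ : wnorm (fisher θs) u = 1) =>
      ENNReal.ofReal ⟪gradient (fun η => Real.log (prior η)) θ, u⟫) u hu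
  · rw [delta01, if_neg hc] at h
    exact absurd rfl h

namespace IsRegularPrior
variable {r D : ℝ}

lemma hasGradientAt_log (hp : IsRegularPrior n θs prior r D) {θ : EuclideanSpace ℝ (Fin d)}
    (hθ : θ ∈ nbhd n θs r) :
    HasGradientAt (fun η => Real.log (prior η)) (gradient (fun η => Real.log (prior η)) θ) θ :=
  ((hp.diff θ hθ).log (hp.pos θ hθ).ne').hasGradientAt

lemma gradient_log_eq (hp : IsRegularPrior n θs prior r D) {θ : EuclideanSpace ℝ (Fin d)}
    (hθ : θ ∈ nbhd n θs r) :
    gradient (fun η => Real.log (prior η)) θ = (prior θ)⁻¹ • gradient prior θ := by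
  refine HasGradientAt.gradient ?_
  have h1 := (hp.diff θ hθ).hasGradientAt.hasFDerivAt.log (hp.pos θ hθ).ne'
  rw [hasGradientAt_iff_hasFDerivAt]
  exact h1.congr_fderiv (by rw [map_smulₛₗ]; simp)

lemma continuousOn_gradient_log (hp : IsRegularPrior n θs prior r D) :
    ContinuousOn (gradient fun η => Real.log (prior η)) (nbhd n θs r) := by
  have h1 : ContinuousOn prior (nbhd n θs r) :=
    fun θ hθ => (hp.diff θ hθ).continuousAt.continuousWithinAt
  exact ((h1.inv₀ fun θ hθ => (hp.pos θ hθ).ne').smul hp.cont).congr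
    fun θ hθ => hp.gradient_log_eq hθ

/-- The frame scales the Fisher norm by 1/√n, so homogeneity turns the dual norm bound D into D/√n.
-/
lemma abs_inner_gradient_le (hp : IsRegularPrior n θs prior r D) (h : IsLocalFrame n s θs p L)
    {θ : EuclideanSpace ℝ (Fin d)} (hθ : θ ∈ nbhd n θs r) (x : EuclideanSpace ℝ (Fin d)) :
    |⟪gradient (fun η => Real.log (prior η)) θ, L x⟫| ≤ D / √n * ‖x‖ := by
  have hn : (0 : ℝ) < √n := Real.sqrt_pos.2 (by exact_mod_cast h.n_pos)
  have key : ∀ x : EuclideanSpace ℝ (Fin d),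
      ⟪gradient (fun η => Real.log (prior η)) θ, L x⟫ ≤ D / √n * ‖x‖ := by
    intro x
    by_cases hx : x = 0
    · simp [hx]
    have hx0 : 0 < ‖x‖ := norm_pos_iff.2 hx
    have h1 := hp.bound θ hθ (L ((√n / ‖x‖) • x)) (by
      rw [h.wnorm_eq, norm_smul, Real.norm_of_nonneg (by positivity)]
      field_simp)
    rw [map_smul, real_inner_smul_right, div_mul_eq_mul_div, div_le_iff₀ hx0] at h1
    rw [div_mul_eq_mul_div, le_div_iff₀ hn]
    linarith
  refine abs_le.2 ⟨?_, key x⟩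
  have := key (-x)
  rw [map_neg, inner_neg_right, norm_neg] at this
  linarith

end IsRegularPrior

/-- The discrepancy of the negative log posterior and its quadratic approximation. -/
noncomputable def discr (n : ℕ) (p : EuclideanSpace ℝ (Fin d))
    (L : EuclideanSpace ℝ (Fin d) ≃L[ℝ] EuclideanSpace ℝ (Fin d))
    (prior : EuclideanSpace ℝ (Fin d) → ℝ) (x : EuclideanSpace ℝ (Fin d)) : ℝ :=
  n * gap p (p + L x) - ‖x‖ ^ 2 / 2 - Real.log (prior (p + L x))

/-- The derivative of the discrepancy. -/
noncomputable def discrDeriv (n : ℕ) (p : EuclideanSpace ℝ (Fin d))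
    (L : EuclideanSpace ℝ (Fin d) ≃L[ℝ] EuclideanSpace ℝ (Fin d))
    (prior : EuclideanSpace ℝ (Fin d) → ℝ) (x : EuclideanSpace ℝ (Fin d)) :
    EuclideanSpace ℝ (Fin d) →L[ℝ] ℝ :=
  (n : ℝ) • (-∑ j, (full p j / full (p + L x) j) • extCLM j).comp
      (L : EuclideanSpace ℝ (Fin d) →L[ℝ] EuclideanSpace ℝ (Fin d)) - innerSL ℝ x -
    (innerSL ℝ (gradient (fun η => Real.log (prior η)) (p + L x))).comp
      (L : EuclideanSpace ℝ (Fin d) →L[ℝ] EuclideanSpace ℝ (Fin d))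

variable {D : ℝ}

lemma hasFDerivAt_affine (x : EuclideanSpace ℝ (Fin d)) :
    HasFDerivAt (fun x => p + L x)
      (L : EuclideanSpace ℝ (Fin d) →L[ℝ] EuclideanSpace ℝ (Fin d)) x :=
  L.hasFDerivAt.const_add p

lemma hasFDerivAt_log_prior (h : IsLocalFrame n s θs p L)
    (hp : IsRegularPrior n θs prior (2 * s) D) {x : EuclideanSpace ℝ (Fin d)}
    (hx : ‖x‖ ≤ √2 * (s * √d)) :
    HasFDerivAt (fun x => Real.log (prior (p + L x)))
      ((innerSL ℝ (gradient (fun η => Real.log (prior η)) (p + L x))).comp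
        (L : EuclideanSpace ℝ (Fin d) →L[ℝ] EuclideanSpace ℝ (Fin d))) x :=
  HasFDerivAt.comp x (f := fun x => p + L x) (hp.hasGradientAt_log (h.mem_nbhd hx)).hasFDerivAt
    (hasFDerivAt_affine x)

lemma hasFDerivAt_discr (h : IsLocalFrame n s θs p L)
    (hp : IsRegularPrior n θs prior (2 * s) D) {x : EuclideanSpace ℝ (Fin d)}
    (hx : ‖x‖ ≤ √2 * (s * √d)) :
    HasFDerivAt (discr n p L prior) (discrDeriv n p L prior x) x := by
  have h1 := (HasFDerivAt.comp x (f := fun x => p + L x) (hasFDerivAt_gap p (h.add_mem hx))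
    (hasFDerivAt_affine x)).const_mul (n : ℝ)
  have h2 : HasFDerivAt (fun x : EuclideanSpace ℝ (Fin d) => ‖x‖ ^ 2 / 2) (innerSL ℝ x) x := by
    have := (hasStrictFDerivAt_norm_sq x).hasFDerivAt.mul_const (2⁻¹ : ℝ)
    refine this.congr_fderiv ?_
    ext v
    simp
  exact (h1.sub h2).sub (hasFDerivAt_log_prior h hp hx)

/-- The source of the first two error terms: the likelihood contributes the slope proportional to
‖x‖, the prior the constant. -/
lemma norm_discrDeriv_le (h : IsLocalFrame n s θs p L)
    (hp : IsRegularPrior n θs prior (2 * s) D) {x : EuclideanSpace ℝ (Fin d)}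
    (hx : ‖x‖ ≤ √2 * (s * √d)) :
    ‖discrDeriv n p L prior x‖ ≤ 4 * (s * √d / √(n * minProb θs)) * ‖x‖ + D / √n := by
  have hη := h.small_nonneg
  have hD := hp.bound_nonneg
  refine ContinuousLinearMap.opNorm_le_bound _ (by positivity) fun v => ?_
  have h1 := h.abs_fderiv_le hx v
  have h2 := hp.abs_inner_gradient_le h (h.mem_nbhd hx) v
  rw [Real.norm_eq_abs, add_mul]
  refine le_trans ?_ (add_le_add h1 h2)
  refine le_trans (le_of_eq ?_) (abs_sub _ _)
  simp [discrDeriv, innerSL_apply_apply]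

lemma continuousOn_discrDeriv (h : IsLocalFrame n s θs p L)
    (hp : IsRegularPrior n θs prior (2 * s) D) :
    ContinuousOn (discrDeriv n p L prior) (Metric.closedBall 0 (√2 * (s * √d))) := by
  have hc : Continuous fun x => p + L x := by fun_prop
  have hg : ContinuousOn (fun x => gradient (fun η => Real.log (prior η)) (p + L x))
      (Metric.closedBall 0 (√2 * (s * √d))) :=
    hp.continuousOn_gradient_log.comp hc.continuousOn
      fun x hx => h.mem_nbhd (mem_closedBall_zero_iff.1 hx)
  have hs : ContinuousOn (fun x => ∑ j, (full p j / full (p + L x) j) • extCLM (d := d) j)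
      (Metric.closedBall 0 (√2 * (s * √d))) := by
    refine continuousOn_finsetSum _ fun j _ => ContinuousOn.fun_smul ?_ continuousOn_const
    refine continuousOn_const.div ((continuous_full j).comp hc).continuousOn fun x hx => ?_
    exact (full_pos (h.add_mem (mem_closedBall_zero_iff.1 hx)) j).ne'
  unfold discrDeriv
  refine ContinuousOn.sub (ContinuousOn.sub ?_ (by fun_prop)) ?_
  · exact ContinuousOn.fun_const_smul (hs.fun_neg.clm_comp continuousOn_const) _
  · exact ((innerSL ℝ).continuous.comp_continuousOn hg).clm_comp continuousOn_const

lemma continuousOn_discr (h : IsLocalFrame n s θs p L)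
    (hp : IsRegularPrior n θs prior (2 * s) D) :
    ContinuousOn (discr n p L prior) (Metric.closedBall 0 (√2 * (s * √d))) :=
  fun _ hx => (hasFDerivAt_discr h hp
    (mem_closedBall_zero_iff.1 hx)).continuousAt.continuousWithinAt

/-- From log(1 - 2c) ≥ 1 - (1 - 2c)⁻¹ ≥ -4c, where the last inequality needs c ≤ 1/4. -/
lemma rpow_neg_half_le {c : ℝ} (hc0 : 0 ≤ c) (hc : c ≤ 1 / 4) (d : ℕ) :
    (1 - 2 * c) ^ (-(d / 2 : ℝ)) ≤ Real.exp (2 * c * d) := by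
  have h1 : 0 < 1 - 2 * c := by linarith
  rw [Real.rpow_def_of_pos h1]
  refine Real.exp_le_exp.2 ?_
  have h2 := Real.one_sub_inv_le_log_of_pos h1
  have h3 : -(4 * c) ≤ 1 - (1 - 2 * c)⁻¹ := by
    have : (1 - 2 * c)⁻¹ ≤ 1 + 4 * c := by
      rw [inv_le_iff_one_le_mul₀ h1]
      nlinarith
    linarith
  have hd : (0 : ℝ) ≤ d / 2 := by positivity
  nlinarith [mul_le_mul_of_nonneg_right (h3.trans h2) hd]

/-- Exponential moments of the differences of the discrepancy at two independent points. -/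
lemma lintegral_exp_discr_sub_le (h : IsLocalFrame n s θs p L)
    (hp : IsRegularPrior n θs prior (2 * s) D)
    (hε : 640 * (s * d / √(n * minProb θs)) ^ 2 ≤ 1) :
    ∫⁻ z in Metric.closedBall (0 : EuclideanSpace ℝ (Fin d)) (s * √d) ×ˢ
        Metric.closedBall (0 : EuclideanSpace ℝ (Fin d)) (s * √d),
      ENNReal.ofReal (Real.exp (2 * -discr n p L prior z.1 - 2 * -discr n p L prior z.2))
        ∂((stdGaussian _).prod (stdGaussian _)) ≤
      ENNReal.ofReal
        (Real.exp (320 * (s * d / √(n * minProb θs)) ^ 2 + 10 * (D / √n) ^ 2)) := by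
  have hd : (1 : ℝ) ≤ d := by exact_mod_cast h.dim_pos
  set η := s * √d / √(n * minProb θs) with hη
  set ε := s * d / √(n * minProb θs) with hεdef
  have hηε : η ^ 2 * d = ε ^ 2 := by
    rw [hη, hεdef, div_pow, div_pow, mul_pow, Real.sq_sqrt (by positivity)]
    ring
  have hη0 : 0 ≤ η := h.small_nonneg
  -- Since d ≥ 1, η ≤ ε. This puts the coefficient 160η² of ‖x‖² below 1/4, where the Gaussian
  -- moment is finite and at most exp(320η²d) = exp(320ε²).
  have hη1 : 640 * η ^ 2 ≤ 1 := by nlinarith [sq_nonneg η]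
  have hpi : Real.pi ^ 2 ≤ 10 := by nlinarith [Real.pi_lt_d2, Real.pi_pos]
  set g : EuclideanSpace ℝ (Fin d) → EuclideanSpace ℝ (Fin d) := fun x =>
    (InnerProductSpace.toDual ℝ _).symm ((2 : ℝ) • discrDeriv n p L prior x) with hg
  have hG : ∀ x ∈ Metric.closedBall (0 : EuclideanSpace ℝ (Fin d)) (√2 * (s * √d)),
      HasGradientAt (fun x => 2 * discr n p L prior x) (g x) x := fun x hx =>
    hasFDerivAt_iff_hasGradientAt.1
      ((hasFDerivAt_discr h hp (mem_closedBall_zero_iff.1 hx)).const_mul 2)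
  have hgc : ContinuousOn g (Metric.closedBall 0 (√2 * (s * √d))) :=
    (InnerProductSpace.toDual ℝ _).symm.continuous.comp_continuousOn
      ((continuousOn_discrDeriv h hp).fun_const_smul 2)
  -- The gradient belongs to twice the discrepancy, so π²/8 becomes π²/2 ≤ 5; with (a + b)² ≤ 2a² +
  -- 2b² this gives 5 · 32 = 160 and 5 · 2 = 10.
  have hgn : ∀ x ∈ Metric.closedBall (0 : EuclideanSpace ℝ (Fin d)) (√2 * (s * √d)),
      Real.pi ^ 2 / 8 * ‖g x‖ ^ 2 ≤ 10 * (D / √n) ^ 2 + 160 * η ^ 2 * ‖x‖ ^ 2 := by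
    intro x hx
    have h1 := norm_discrDeriv_le h hp (mem_closedBall_zero_iff.1 hx)
    have h2 : ‖g x‖ = 2 * ‖discrDeriv n p L prior x‖ := by
      rw [hg]; simp [norm_smul]
    rw [h2]
    have h3 : ‖discrDeriv n p L prior x‖ ^ 2 ≤ (4 * η * ‖x‖ + D / √n) ^ 2 :=
      pow_le_pow_left₀ (norm_nonneg _) h1 2
    have h4 : (4 * η * ‖x‖ + D / √n) ^ 2 ≤ 32 * η ^ 2 * ‖x‖ ^ 2 + 2 * (D / √n) ^ 2 := by
      nlinarith [sq_nonneg (4 * η * ‖x‖ - D / √n)]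
    calc _ = Real.pi ^ 2 * (‖discrDeriv n p L prior x‖ ^ 2 / 2) := by ring
      _ ≤ 10 * ((32 * η ^ 2 * ‖x‖ ^ 2 + 2 * (D / √n) ^ 2) / 2) := by
          have := h3.trans h4
          gcongr
      _ = _ := by ring
  calc _ = ∫⁻ z in Metric.closedBall (0 : EuclideanSpace ℝ (Fin d)) (s * √d) ×ˢ
        Metric.closedBall (0 : EuclideanSpace ℝ (Fin d)) (s * √d),
        ENNReal.ofReal (Real.exp (2 * discr n p L prior z.2 - 2 * discr n p L prior z.1))
        ∂((stdGaussian _).prod (stdGaussian _)) := by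
        refine lintegral_congr fun z => ?_
        congr 2
        ring
    _ ≤ ∫⁻ x in Metric.closedBall (0 : EuclideanSpace ℝ (Fin d)) (√2 * (s * √d)),
        ENNReal.ofReal (Real.exp (Real.pi ^ 2 / 8 * ‖g x‖ ^ 2)) ∂stdGaussian _ :=
        lintegral_exp_sub_le hG hgc
    _ ≤ ∫⁻ x in Metric.closedBall (0 : EuclideanSpace ℝ (Fin d)) (√2 * (s * √d)),
        ENNReal.ofReal (Real.exp (10 * (D / √n) ^ 2)) *
          ENNReal.ofReal (Real.exp (160 * η ^ 2 * ‖x‖ ^ 2)) ∂stdGaussian _ := by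
        refine setLIntegral_mono' Metric.isClosed_closedBall.measurableSet fun x hx => ?_
        rw [← ENNReal.ofReal_mul (by positivity), ← Real.exp_add]
        exact ENNReal.ofReal_le_ofReal (Real.exp_le_exp.2 (hgn x hx))
    _ ≤ ∫⁻ x, ENNReal.ofReal (Real.exp (10 * (D / √n) ^ 2)) *
          ENNReal.ofReal (Real.exp (160 * η ^ 2 * ‖x‖ ^ 2)) ∂stdGaussian _ :=
        setLIntegral_le_lintegral _ _
    _ = ENNReal.ofReal (Real.exp (10 * (D / √n) ^ 2)) *
        ENNReal.ofReal ((1 - 2 * (160 * η ^ 2)) ^ (-(d / 2 : ℝ))) := by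
        rw [lintegral_const_mul _ (by fun_prop),
          lintegral_exp_mul_sq_norm_stdGaussian (by linarith), finrank_euclideanSpace_fin]
    _ ≤ _ := by
        rw [← ENNReal.ofReal_mul (by positivity), add_comm, Real.exp_add]
        refine ENNReal.ofReal_le_ofReal (mul_le_mul_of_nonneg_left ?_ (Real.exp_pos _).le)
        refine (rpow_neg_half_le (by positivity) (by linarith) d).trans (Real.exp_le_exp.2 ?_)
        rw [← hηε]
        linarith

/-- The prior does not vary much on the neighbourhood. -/
lemma abs_log_prior_sub_le (h : IsLocalFrame n s θs p L)
    (hp : IsRegularPrior n θs prior (2 * s) D) {x y : EuclideanSpace ℝ (Fin d)}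
    (hx : ‖x‖ ≤ s * √d) (hy : ‖y‖ ≤ s * √d) :
    |Real.log (prior (p + L x)) - Real.log (prior (p + L y))| ≤ D / √n * ‖x - y‖ := by
  have hs := h.s_pos
  have hD := hp.bound_nonneg
  have hle : s * √d ≤ √2 * (s * √d) :=
    le_mul_of_one_le_left (by positivity) (Real.one_le_sqrt.2 (by norm_num))
  have := (convex_closedBall (0 : EuclideanSpace ℝ (Fin d))
    (s * √d)).norm_image_sub_le_of_norm_hasFDerivWithin_le (𝕜 := ℝ) (C := D / √n)
    (f := fun x => Real.log (prior (p + L x))) (x := y) (y := x)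
    (fun z hz => (hasFDerivAt_log_prior h hp
      ((mem_closedBall_zero_iff.1 hz).trans hle)).hasFDerivWithinAt) ?_ (by simpa) (by simpa)
  · simpa using this
  · intro z hz
    refine ContinuousLinearMap.opNorm_le_bound _ (by positivity) fun v => ?_
    exact hp.abs_inner_gradient_le h (h.mem_nbhd ((mem_closedBall_zero_iff.1 hz).trans hle)) v
end Prior

/-! ### Normalization and tails of the posterior -/

section Tails
open scoped RealInnerProductSpace ENNReal
variable {d n : ℕ} {s : ℝ} {θs p : EuclideanSpace ℝ (Fin d)}
  {L : EuclideanSpace ℝ (Fin d) ≃L[ℝ] EuclideanSpace ℝ (Fin d)}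
  {prior : EuclideanSpace ℝ (Fin d) → ℝ}

lemma integral_exp_neg_mul_abs {b : ℝ} (hb : 0 < b) : ∫ t : ℝ, Real.exp (-b * |t|) = 2 / b := by
  rw [integral_comp_abs (f := fun t => Real.exp (-b * t)), integral_exp_mul_Ioi (by linarith)]
  simp
  ring

lemma integrable_exp_neg_mul_abs {b : ℝ} (hb : 0 < b) :
    Integrable fun t : ℝ => Real.exp (-b * |t|) :=
  .of_integral_ne_zero (by rw [integral_exp_neg_mul_abs hb]; positivity)

/-- The bound ‖x‖₁ ≤ √d ‖x‖₂ reduces the integral to a product of d one-dimensional Laplace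
integrals. -/
lemma lintegral_exp_neg_mul_norm_le {a : ℝ} (ha : 0 < a) (hd : 1 ≤ d) :
    ∫⁻ x : EuclideanSpace ℝ (Fin d), ENNReal.ofReal (Real.exp (-a * ‖x‖)) ≤
      ENNReal.ofReal ((2 * √d / a) ^ d) := by
  have hd0 : (0 : ℝ) < √d := Real.sqrt_pos.2 (by exact_mod_cast hd)
  have hb : 0 < a / √d := by positivity
  rw [← (PiLp.volume_preserving_toLp (Fin d)).lintegral_comp (by fun_prop)]
  have hle : ∀ x : Fin d → ℝ, ENNReal.ofReal (Real.exp (-a * ‖WithLp.toLp 2 x‖)) ≤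
      ENNReal.ofReal (∏ i, Real.exp (-(a / √d) * |x i|)) := by
    intro x
    refine ENNReal.ofReal_le_ofReal ?_
    rw [← Real.exp_sum, ← Finset.mul_sum]
    refine Real.exp_le_exp.2 ?_
    have h1 : ∑ i, |x i| ≤ √d * ‖WithLp.toLp 2 x‖ := by
      have := Real.sum_mul_le_sqrt_mul_sqrt Finset.univ (fun _ : Fin d => (1 : ℝ)) (fun i => |x i|)
      rw [EuclideanSpace.norm_eq]
      simpa using this
    have h2 := mul_le_mul_of_nonneg_left h1 hb.le
    rw [← mul_assoc, div_mul_cancel₀ _ hd0.ne'] at h2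
    linarith
  refine (lintegral_mono hle).trans (le_of_eq ?_)
  rw [volume_pi, ← ofReal_integral_eq_lintegral_ofReal
    (Integrable.fintype_prod (f := fun (_ : Fin d) t => Real.exp (-(a / √d) * |t|))
      fun _ => integrable_exp_neg_mul_abs hb)
    (ae_of_all _ fun _ => Finset.prod_nonneg fun _ _ => (Real.exp_pos _).le),
    ← volume_pi, integral_fintype_prod_volume_eq_pow (fun t => Real.exp (-(a / √d) * |t|)),
    integral_exp_neg_mul_abs hb, Fintype.card_fin]
  congr 2
  field_simp

/-- A set of volume one within distance √d/2 of the origin: bounding the normalizing constant from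
below on it needs no ball volumes. -/
lemma volume_unitCube : volume {x : EuclideanSpace ℝ (Fin d) | ∀ i, |x i| ≤ 1 / 2} = 1 := by
  have h : (@WithLp.toLp 2 (Fin d → ℝ)) ⁻¹' {x : EuclideanSpace ℝ (Fin d) | ∀ i, |x i| ≤ 1 / 2} =
      Set.Icc (fun _ => -(1 / 2)) (fun _ => 1 / 2) := by
    ext x
    simp [abs_le, Set.mem_Icc, Pi.le_def, forall_and]
  rw [← (PiLp.volume_preserving_toLp (Fin d)).measure_preimage_emb
    (MeasurableEquiv.toLp 2 (Fin d → ℝ)).measurableEmbedding, h, Real.volume_Icc_pi]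
  norm_num

lemma norm_le_of_mem_unitCube {x : EuclideanSpace ℝ (Fin d)} (hx : ∀ i, |x i| ≤ 1 / 2) :
    ‖x‖ ≤ √d / 2 := by
  have : √d / 2 = √(d / 4) := by
    rw [Real.sqrt_div (by positivity), show (4 : ℝ) = 2 ^ 2 by norm_num,
      Real.sqrt_sq (by norm_num)]
  rw [EuclideanSpace.norm_eq, this]
  refine Real.sqrt_le_sqrt ?_
  calc ∑ i, ‖x i‖ ^ 2 ≤ ∑ _i : Fin d, (1 / 4 : ℝ) := by
        refine Finset.sum_le_sum fun i _ => ?_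
        rw [Real.norm_eq_abs]
        have := hx i
        nlinarith [abs_nonneg (x i)]
    _ = _ := by simp; ring

/-- Markov's inequality for exp(‖x‖²/4), whose mean is at most e^{d/2}. -/
lemma measure_closedBall_compl_le (hd : 1 ≤ d) (hs : 16 ≤ s) :
    (stdGaussian (EuclideanSpace ℝ (Fin d))).real (Metric.closedBall 0 (s * √d))ᶜ ≤
      Real.exp (-(d * s ^ 2 / 8)) := by
  have hd0 : (1 : ℝ) ≤ d := by exact_mod_cast hd
  set γ := stdGaussian (EuclideanSpace ℝ (Fin d))
  refine ENNReal.toReal_le_of_le_ofReal (Real.exp_pos _).le ?_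
  have h1 := lintegral_exp_mul_sq_norm_stdGaussian (E := EuclideanSpace ℝ (Fin d))
    (c := 1 / 4) (by norm_num)
  rw [finrank_euclideanSpace_fin] at h1
  have h2 : ENNReal.ofReal (Real.exp (d * s ^ 2 / 4)) * γ (Metric.closedBall 0 (s * √d))ᶜ ≤
      ENNReal.ofReal (Real.exp (d / 2)) := by
    rw [← setLIntegral_const]
    calc _ ≤ ∫⁻ x in (Metric.closedBall 0 (s * √d))ᶜ,
          ENNReal.ofReal (Real.exp (1 / 4 * ‖x‖ ^ 2)) ∂γ := by
          refine setLIntegral_mono' Metric.isClosed_closedBall.measurableSet.compl fun x hx => ?_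
          refine ENNReal.ofReal_le_ofReal (Real.exp_le_exp.2 ?_)
          simp only [Set.mem_compl_iff, mem_closedBall_zero_iff, not_le] at hx
          have h3 : (s * √d) ^ 2 ≤ ‖x‖ ^ 2 := pow_le_pow_left₀ (by positivity) hx.le 2
          rw [mul_pow, Real.sq_sqrt (by positivity)] at h3
          linarith
      _ ≤ ∫⁻ x, ENNReal.ofReal (Real.exp (1 / 4 * ‖x‖ ^ 2)) ∂γ := setLIntegral_le_lintegral _ _
      _ ≤ _ := by
          rw [h1]
          refine ENNReal.ofReal_le_ofReal ((rpow_neg_half_le (by norm_num) le_rfl d).trans ?_)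
          exact Real.exp_le_exp.2 (by linarith)
  rw [mul_comm, ← ENNReal.le_div_iff_mul_le (Or.inl (by simp [Real.exp_pos]))
    (Or.inl ENNReal.ofReal_ne_top), ← ENNReal.ofReal_div_of_pos (Real.exp_pos _),
    ← Real.exp_sub] at h2
  refine h2.trans (ENNReal.ofReal_le_ofReal (Real.exp_le_exp.2 ?_))
  have : 256 ≤ s ^ 2 := by nlinarith
  nlinarith

/-- The posterior, up to normalization, in the coordinates of a local frame. -/
noncomputable def pullback (n : ℕ) (p : EuclideanSpace ℝ (Fin d))
    (L : EuclideanSpace ℝ (Fin d) ≃L[ℝ] EuclideanSpace ℝ (Fin d))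
    (prior : EuclideanSpace ℝ (Fin d) → ℝ) : Measure (EuclideanSpace ℝ (Fin d)) :=
  (volume.restrict {x | p + L x ∈ paramSpace d}).withDensity fun x =>
    ENNReal.ofReal (Real.exp (-(n * gap p (p + L x))) * prior (p + L x))

lemma tv_map_le {α β : Type*} [MeasurableSpace α] [MeasurableSpace β] {μ ν : Measure α}
    {T : α → β} (hT : Measurable T) : tv (μ.map T) (ν.map T) ≤ tv μ ν := by
  refine iSup₂_le fun A hA => ?_
  rw [map_measureReal_apply hT hA, map_measureReal_apply hT hA]
  exact le_iSup₂ (f := fun A (_ : MeasurableSet A) => ENNReal.ofReal |μ.real A - ν.real A|)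
    (T ⁻¹' A) (hT hA)

lemma tv_le_one {α : Type*} [MeasurableSpace α] (μ ν : Measure α) [IsProbabilityMeasure μ]
    [IsProbabilityMeasure ν] : tv μ ν ≤ 1 := by
  refine iSup₂_le fun A _ => ?_
  rw [← ENNReal.ofReal_one]
  refine ENNReal.ofReal_le_ofReal (abs_le.2 ⟨?_, ?_⟩)
  · linarith [measureReal_nonneg (μ := μ) (s := A), measureReal_le_one (μ := ν) (s := A)]
  · linarith [measureReal_nonneg (μ := ν) (s := A), measureReal_le_one (μ := μ) (s := A)]

/-- The constant collects the Jacobian of L and the maximal likelihood e^{-nℓ(p)}; both disappear on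
normalization. -/
lemma posteriorWeight_eq_smul_map (hn : 0 < n) {N : Fin (d + 1) → ℕ} (hN : ∑ j, N j = n)
    (L : EuclideanSpace ℝ (Fin d) ≃L[ℝ] EuclideanSpace ℝ (Fin d))
    (prior : EuclideanSpace ℝ (Fin d) → ℝ) :
    ∃ c : ℝ≥0∞, c ≠ 0 ∧ c ≠ ⊤ ∧ posteriorWeight n prior N =
      c • (pullback n (freq n N) L prior).map fun x => freq n N + L x := by
  set p := freq n N with hp
  have hdet : LinearMap.det (L : EuclideanSpace ℝ (Fin d) →ₗ[ℝ] EuclideanSpace ℝ (Fin d)) ≠ 0 :=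
    L.toLinearEquiv.isUnit_det'.ne_zero
  set k := ENNReal.ofReal
    |(LinearMap.det (L : EuclideanSpace ℝ (Fin d) →ₗ[ℝ] EuclideanSpace ℝ (Fin d)))⁻¹| with hk
  have hk0 : k ≠ 0 := by simpa [hk] using hdet
  set e : EuclideanSpace ℝ (Fin d) ≃ᵐ EuclideanSpace ℝ (Fin d) :=
    (L.toHomeomorph.trans (Homeomorph.addLeft p)).toMeasurableEquiv with he
  have hee : (fun x => p + L x) = e := rfl
  have hmap : (volume : Measure (EuclideanSpace ℝ (Fin d))).map e = k • volume := by
    have h1 : (volume : Measure (EuclideanSpace ℝ (Fin d))).map L = k • volume :=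
      Measure.map_linearMap_addHaar_eq_smul_addHaar volume hdet
    have h2 : (e : EuclideanSpace ℝ (Fin d) → EuclideanSpace ℝ (Fin d)) =
      (fun x => p + x) ∘ L := rfl
    rw [h2, ← Measure.map_map (by fun_prop) (by fun_prop), h1, Measure.map_smul,
      map_add_left_eq_self]
  set w := ENNReal.ofReal (Real.exp (-(n * negLogLik n N p))) with hw
  have hw0 : w ≠ 0 := by simp [hw, Real.exp_pos]
  refine ⟨w * k⁻¹, mul_ne_zero hw0 (ENNReal.inv_ne_zero.2 ENNReal.ofReal_ne_top),
    ENNReal.mul_ne_top ENNReal.ofReal_ne_top (ENNReal.inv_ne_top.2 hk0), ?_⟩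
  have hΘ : MeasurableSet (paramSpace d) := isOpen_paramSpace.measurableSet
  ext A hA
  rw [hee, Measure.smul_apply, Measure.map_apply e.measurable hA, posteriorWeight, pullback,
    withDensity_apply _ hA, withDensity_apply _ (e.measurable hA), Measure.restrict_restrict hA,
    Measure.restrict_restrict (e.measurable hA)]
  have hset : e ⁻¹' A ∩ {x | p + L x ∈ paramSpace d} = e ⁻¹' (A ∩ paramSpace d) := rfl
  rw [hset]
  have h3 : ∫⁻ x in e ⁻¹' (A ∩ paramSpace d),
      ENNReal.ofReal (Real.exp (-(n * gap p (p + L x))) * prior (p + L x)) =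
      k * ∫⁻ θ in A ∩ paramSpace d, ENNReal.ofReal (Real.exp (-(n * gap p θ)) * prior θ) := by
    rw [← smul_eq_mul, ← lintegral_smul_measure, ← Measure.restrict_smul, ← hmap,
      e.restrict_map, lintegral_map_equiv]
    rfl
  rw [h3, smul_eq_mul, ← mul_assoc, mul_assoc w, ENNReal.inv_mul_cancel hk0 ENNReal.ofReal_ne_top,
    mul_one, ← lintegral_const_mul' _ _ ENNReal.ofReal_ne_top]
  refine lintegral_congr fun θ => ?_
  rw [← ENNReal.ofReal_mul (Real.exp_pos _).le, ← mul_assoc, ← Real.exp_add,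
    negLogLik_sub hn hN θ]
  congr 3
  ring

lemma posterior_eq_map (hn : 0 < n) {N : Fin (d + 1) → ℕ} (hN : ∑ j, N j = n)
    (L : EuclideanSpace ℝ (Fin d) ≃L[ℝ] EuclideanSpace ℝ (Fin d))
    (prior : EuclideanSpace ℝ (Fin d) → ℝ) :
    posterior n prior N = ((pullback n (freq n N) L prior Set.univ)⁻¹ •
      pullback n (freq n N) L prior).map fun x => freq n N + L x := by
  obtain ⟨c, hc0, hct, hc⟩ := posteriorWeight_eq_smul_map hn hN L prior
  have hm : Measurable fun x => freq n N + L x := by fun_prop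
  rw [posterior, hc, Measure.map_smul, smul_smul, Measure.smul_apply, Measure.map_apply hm .univ,
    smul_eq_mul, Set.preimage_univ, ENNReal.mul_inv (Or.inl hc0) (Or.inl hct), mul_right_comm,
    ENNReal.inv_mul_cancel hc0 hct, one_mul]

lemma negLogLik_nonneg (n : ℕ) (N : Fin (d + 1) → ℕ) {θ : EuclideanSpace ℝ (Fin d)}
    (hθ : θ ∈ paramSpace d) : 0 ≤ negLogLik n N θ := by
  rw [negLogLik, ← Finset.sum_neg_distrib]
  refine Finset.sum_nonneg fun j _ => ?_
  have h1 : full θ j ≤ 1 := by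
    rw [← sum_full θ]
    exact Finset.single_le_sum (fun i _ => (full_pos hθ i).le) (Finset.mem_univ j)
  have := Real.log_nonpos (full_pos hθ j).le h1
  have h2 : (0 : ℝ) ≤ (N j : ℝ) / n := by positivity
  nlinarith

/-- The likelihood is at most one, so integrability of the prior suffices. -/
lemma posteriorWeight_univ_lt_top (hprior : ∀ θ ∈ paramSpace d, 0 ≤ prior θ)
    (hint : IntegrableOn prior (paramSpace d) volume) (N : Fin (d + 1) → ℕ) :
    posteriorWeight n prior N Set.univ < ⊤ := by
  have hΘ : MeasurableSet (paramSpace d) := isOpen_paramSpace.measurableSet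
  rw [posteriorWeight, withDensity_apply _ .univ, Measure.restrict_univ]
  refine lt_of_le_of_lt (setLIntegral_mono' hΘ fun θ hθ => ENNReal.ofReal_le_ofReal ?_)
    (hint.lintegral_lt_top)
  refine mul_le_of_le_one_left (hprior θ hθ) (Real.exp_le_one_iff.2 ?_)
  have := negLogLik_nonneg n N hθ
  have h2 : (0 : ℝ) ≤ n := by positivity
  nlinarith [mul_nonneg h2 this]

lemma pullback_univ_lt_top (hn : 0 < n) {N : Fin (d + 1) → ℕ} (hN : ∑ j, N j = n)
    (hprior : ∀ θ ∈ paramSpace d, 0 ≤ prior θ)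
    (hint : IntegrableOn prior (paramSpace d) volume) :
    pullback n (freq n N) L prior Set.univ < ⊤ := by
  obtain ⟨c, hc0, hct, hc⟩ := posteriorWeight_eq_smul_map hn hN L prior
  have h := posteriorWeight_univ_lt_top (n := n) hprior hint N
  have hm : Measurable fun x => freq n N + L x := by fun_prop
  rw [hc, Measure.smul_apply, Measure.map_apply hm .univ, smul_eq_mul, Set.preimage_univ] at h
  by_contra htop
  rw [not_lt, top_le_iff] at htop
  rw [htop, ENNReal.mul_top hc0] at h
  exact lt_irrefl _ h

lemma sqrt_two_mul_le {a : ℝ} (ha : 0 ≤ a) : a ≤ √2 * a :=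
  le_mul_of_one_le_left ha (Real.one_le_sqrt.2 (by norm_num))

/-- The Gaussian density cancels the quadratic term of the discrepancy. Positivity of the prior on
the ball allows it to be written as an exponential. -/
lemma pullback_restrict_closedBall {D : ℝ} (h : IsLocalFrame n s θs p L)
    (hp : IsRegularPrior n θs prior (2 * s) D) :
    ∃ c : ℝ≥0∞, c ≠ 0 ∧ c ≠ ⊤ ∧
      (pullback n p L prior).restrict (Metric.closedBall 0 (s * √d)) =
      c • ((stdGaussian (EuclideanSpace ℝ (Fin d))).restrict
        (Metric.closedBall 0 (s * √d))).withDensity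
        fun x => ENNReal.ofReal (Real.exp (-discr n p L prior x)) := by
  have hs := h.s_pos
  set B := Metric.closedBall (0 : EuclideanSpace ℝ (Fin d)) (s * √d) with hBdef
  have hB : MeasurableSet B := Metric.isClosed_closedBall.measurableSet
  have hBx : ∀ x ∈ B, ‖x‖ ≤ √2 * (s * √d) := fun x hx =>
    (mem_closedBall_zero_iff.1 hx).trans (sqrt_two_mul_le (by positivity))
  set κ := (2 * Real.pi) ^ (-((d : ℝ) / 2)) with hκ
  have hκ0 : 0 < κ := by positivity
  refine ⟨ENNReal.ofReal κ⁻¹, by simpa using hκ0, ENNReal.ofReal_ne_top, ?_⟩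
  have hdm : AEMeasurable (discr n p L prior) (volume.restrict B) :=
    ((continuousOn_discr h hp).mono fun x hx =>
      mem_closedBall_zero_iff.2 (hBx x hx)).aemeasurable hB
  have hΘB : B ⊆ {x | p + L x ∈ paramSpace d} := fun x hx => h.add_mem (hBx x hx)
  rw [stdGaussian_eq_withDensity, finrank_euclideanSpace_fin, restrict_withDensity hB, pullback,
    restrict_withDensity hB, Measure.restrict_restrict hB, Set.inter_eq_left.2 hΘB,
    ← withDensity_mul₀ (by fun_prop) (by fun_prop), ← withDensity_smul' _ _ ENNReal.ofReal_ne_top]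
  refine withDensity_congr_ae ?_
  filter_upwards [ae_restrict_mem hB] with x hx
  have hpos := hp.pos _ (h.mem_nbhd (hBx x hx))
  simp only [Pi.smul_apply, Pi.mul_apply, smul_eq_mul]
  rw [← ENNReal.ofReal_mul (by positivity), ← ENNReal.ofReal_mul (by positivity)]
  congr 1
  have e : Real.exp (-discr n p L prior x) = Real.exp (-(n * gap p (p + L x))) *
      Real.exp (‖x‖ ^ 2 / 2) * prior (p + L x) := by
    rw [← Real.exp_log hpos, ← Real.exp_add, ← Real.exp_add, discr]
    congr 1
    ring
  have e2 : Real.exp (-(1 / 2) * ‖x‖ ^ 2) * Real.exp (‖x‖ ^ 2 / 2) = 1 := by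
    rw [← Real.exp_add]; ring_nf; exact Real.exp_zero
  rw [e]
  calc _ = (κ⁻¹ * κ) * (Real.exp (-(1 / 2) * ‖x‖ ^ 2) * Real.exp (‖x‖ ^ 2 / 2)) *
        (Real.exp (-(n * gap p (p + L x))) * prior (p + L x)) := by
        rw [e2, inv_mul_cancel₀ hκ0.ne', one_mul, one_mul]
    _ = _ := by ring

/-- On the unit cube n KL ≤ 4 · d/4 = d. The logarithm of the prior has slope at most D/√n ≤ √d/6
and the cube is within s√d of the preimage of θ*, so it loses at most ds/6; this is the use of the
bound √(nd)/6. -/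
lemma le_pullback_univ {D : ℝ} (h : IsLocalFrame n s θs p L)
    (hp : IsRegularPrior n θs prior (2 * s) D) (hD : D ≤ √(n * d) / 6) :
    ENNReal.ofReal (prior θs * Real.exp (-(d + d * s / 6))) ≤
      pullback n p L prior Set.univ := by
  have hs := h.s_pos
  have hn : (0 : ℝ) < √n := Real.sqrt_pos.2 (by exact_mod_cast h.n_pos)
  set Q := {x : EuclideanSpace ℝ (Fin d) | ∀ i, |x i| ≤ 1 / 2} with hQ
  have hQm : MeasurableSet Q := by
    have : Q = ⋂ i, {x : EuclideanSpace ℝ (Fin d) | |x i| ≤ 1 / 2} := by ext; simp [hQ]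
    rw [this]
    exact MeasurableSet.iInter fun i => measurableSet_le (by fun_prop) measurable_const
  have hQx : ∀ x ∈ Q, ‖x‖ ≤ √d / 2 := fun x hx => norm_le_of_mem_unitCube hx
  have hd0 := Real.sqrt_nonneg (d : ℝ)
  have hQs : ∀ x ∈ Q, ‖x‖ ≤ s * √d := fun x hx => (hQx x hx).trans (by nlinarith)
  have hQ2 : ∀ x ∈ Q, ‖x‖ ≤ √2 * (s * √d) := fun x hx =>
    (hQs x hx).trans (sqrt_two_mul_le (by positivity))
  set x₀ := L.symm (θs - p) with hx₀
  have hx₀n : ‖x₀‖ ≤ s / 2 * √d := by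
    have := h.norm_close
    rwa [← norm_neg, ← map_neg, neg_sub] at this
  have hpx₀ : p + L x₀ = θs := by rw [hx₀, L.apply_symm_apply]; abel
  have hx₀s : ‖x₀‖ ≤ s * √d := hx₀n.trans (by nlinarith [mul_nonneg (by linarith : 0 ≤ s) hd0])
  have hθpos : 0 < prior θs := by
    have := hp.pos _ (h.mem_nbhd (hx₀s.trans (sqrt_two_mul_le (by positivity))))
    rwa [hpx₀] at this
  have hpt : ∀ x ∈ Q, prior θs * Real.exp (-(d + d * s / 6)) ≤
      Real.exp (-(n * gap p (p + L x))) * prior (p + L x) := by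
    intro x hx
    have h1 := (h.gap_bounds (hQ2 x hx)).2
    have h2 := (abs_le.1 (abs_log_prior_sub_le h hp (hQs x hx) hx₀s)).1
    rw [hpx₀] at h2
    have h3 : D / √n * ‖x - x₀‖ ≤ d * s / 6 := by
      have h4 : ‖x - x₀‖ ≤ s * √d := by
        refine (norm_sub_le _ _).trans ((add_le_add (hQx x hx) hx₀n).trans ?_)
        nlinarith
      have h5 : D / √n ≤ √d / 6 := by
        rw [div_le_iff₀ hn]
        rw [Real.sqrt_mul (by positivity)] at hD
        linarith
      calc _ ≤ √d / 6 * (s * √d) := by gcongr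
        _ = (√d * √d) * s / 6 := by ring
        _ = _ := by rw [Real.mul_self_sqrt (by positivity)]
    have h6 : ‖x‖ ^ 2 ≤ d / 4 := by
      have := pow_le_pow_left₀ (norm_nonneg x) (hQx x hx) 2
      rw [div_pow, Real.sq_sqrt (by positivity)] at this
      linarith
    have hpx := hp.pos _ (h.mem_nbhd (hQ2 x hx))
    rw [← Real.exp_log hθpos, ← Real.exp_log hpx, ← Real.exp_add, ← Real.exp_add]
    refine Real.exp_le_exp.2 ?_
    linarith
  have hΘ : Q ⊆ {x | p + L x ∈ paramSpace d} := fun x hx => h.add_mem (hQ2 x hx)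
  calc _ = ∫⁻ _x in Q, ENNReal.ofReal (prior θs * Real.exp (-(d + d * s / 6))) := by
        rw [setLIntegral_const, volume_unitCube, mul_one]
    _ ≤ ∫⁻ x in Q, ENNReal.ofReal (Real.exp (-(n * gap p (p + L x))) * prior (p + L x)) :=
        setLIntegral_mono' hQm fun x hx => ENNReal.ofReal_le_ofReal (hpt x hx)
    _ = pullback n p L prior Q := by
        rw [pullback, withDensity_apply _ hQm, Measure.restrict_restrict hQm,
          Set.inter_eq_left.2 hΘ]
    _ ≤ _ := measure_mono (Set.subset_univ _)

/-- Half of the linear growth gives the factor e^{-ds²/24} at the boundary. The other half makes the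
integral converge, with value at most (48/s)^d ≤ 1; hence s ≥ 48. -/
lemma pullback_closedBall_compl_le (h : IsLocalFrame n s θs p L) (hs : 48 ≤ s)
    {S : ℝ} (hS : ∀ θ ∈ paramSpace d, prior θ ≤ S) (hS0 : 0 ≤ S) :
    pullback n p L prior (Metric.closedBall 0 (s * √d))ᶜ ≤
      ENNReal.ofReal (S * Real.exp (-(d * s ^ 2 / 24))) := by
  have hd0 : (0 : ℝ) < √d := Real.sqrt_pos.2 (by exact_mod_cast h.dim_pos)
  have hΘ : MeasurableSet {x | p + L x ∈ paramSpace d} := by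
    have hc : Continuous fun x => p + L x := by fun_prop
    exact (isOpen_paramSpace.preimage hc).measurableSet
  have hB : MeasurableSet (Metric.closedBall (0 : EuclideanSpace ℝ (Fin d)) (s * √d))ᶜ :=
    Metric.isClosed_closedBall.measurableSet.compl
  have hR2 : (s * √d) ^ 2 = d * s ^ 2 := by
    rw [mul_pow, Real.sq_sqrt (by positivity)]; ring
  have ha : 0 < s * √d / 24 := by positivity
  rw [pullback, withDensity_apply _ hB, Measure.restrict_restrict hB]
  calc _ ≤ ∫⁻ x in (Metric.closedBall 0 (s * √d))ᶜ ∩ {x | p + L x ∈ paramSpace d},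
        ENNReal.ofReal (S * Real.exp (-(d * s ^ 2 / 24))) *
          ENNReal.ofReal (Real.exp (-(s * √d / 24) * ‖x‖)) := by
        refine setLIntegral_mono' (hB.inter hΘ) fun x hx => ?_
        obtain ⟨hx1, hx2⟩ := hx
        simp only [Set.mem_compl_iff, mem_closedBall_zero_iff, not_le] at hx1
        rw [← ENNReal.ofReal_mul (by positivity)]
        refine ENNReal.ofReal_le_ofReal ?_
        have h1 := h.linear_growth hx1.le hx2
        have h2 : Real.exp (-(n * gap p (p + L x))) ≤
            Real.exp (-(d * s ^ 2 / 24)) * Real.exp (-(s * √d / 24) * ‖x‖) := by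
          rw [← Real.exp_add]
          refine Real.exp_le_exp.2 ?_
          have h3 : s * √d * (s * √d) ≤ s * √d * ‖x‖ :=
            mul_le_mul_of_nonneg_left hx1.le (by positivity)
          nlinarith
        calc _ ≤ Real.exp (-(n * gap p (p + L x))) * S :=
              mul_le_mul_of_nonneg_left (hS _ hx2) (Real.exp_pos _).le
          _ ≤ Real.exp (-(d * s ^ 2 / 24)) * Real.exp (-(s * √d / 24) * ‖x‖) * S := by gcongr
          _ = _ := by ring
    _ ≤ ∫⁻ x, ENNReal.ofReal (S * Real.exp (-(d * s ^ 2 / 24))) *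
          ENNReal.ofReal (Real.exp (-(s * √d / 24) * ‖x‖)) := setLIntegral_le_lintegral _ _
    _ ≤ ENNReal.ofReal (S * Real.exp (-(d * s ^ 2 / 24))) *
        ENNReal.ofReal ((2 * √d / (s * √d / 24)) ^ d) := by
        rw [lintegral_const_mul _ (by fun_prop)]
        gcongr
        exact lintegral_exp_neg_mul_norm_le ha h.dim_pos
    _ ≤ _ := by
        refine mul_le_of_le_one_right (by positivity) ?_
        rw [← ENNReal.ofReal_one]
        refine ENNReal.ofReal_le_ofReal (pow_le_one₀ (by positivity) ?_)
        rw [div_le_one ha]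
        nlinarith
end Tails

/-! ### Assembly of the error bound -/

section Main
open scoped RealInnerProductSpace ENNReal
variable {d n : ℕ} {s : ℝ} {θs p : EuclideanSpace ℝ (Fin d)}
  {L : EuclideanSpace ℝ (Fin d) ≃L[ℝ] EuclideanSpace ℝ (Fin d)}
  {prior : EuclideanSpace ℝ (Fin d) → ℝ}

/-- By (1 - t)⁻² ≤ e^{4t} and e^y - 1 ≤ 2y for 0 ≤ y ≤ 1, the radicand is at most 640a² + 20b² + 8t,
below 26²a² + 5²b² + 3²t. -/
lemma sqrt_exp_div_sq_sub_one_le {a b t : ℝ} (ha : 0 ≤ a) (hb : 0 ≤ b) (ht : 0 ≤ t)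
    (ht2 : t ≤ 1 / 2) (hle : 320 * a ^ 2 + 10 * b ^ 2 + 4 * t ≤ 1) :
    √(Real.exp (320 * a ^ 2 + 10 * b ^ 2) / (1 - t) ^ 2 - 1) ≤ 26 * a + 5 * b + 3 * √t := by
  have h1 : 1 / (1 - t) ^ 2 ≤ Real.exp (4 * t) := by
    have h2 : 1 ≤ Real.exp (2 * t) * (1 - t) := by
      have := Real.add_one_le_exp (2 * t)
      nlinarith [mul_le_mul_of_nonneg_right this (by linarith : 0 ≤ 1 - t)]
    rw [div_le_iff₀ (by nlinarith)]
    calc (1 : ℝ) ≤ (Real.exp (2 * t) * (1 - t)) ^ 2 := one_le_pow₀ h2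
      _ = _ := by rw [mul_pow, ← Real.exp_nat_mul]; push_cast; ring_nf
  have h3 : Real.exp (320 * a ^ 2 + 10 * b ^ 2) / (1 - t) ^ 2 - 1 ≤
      2 * (320 * a ^ 2 + 10 * b ^ 2 + 4 * t) := by
    have h4 : 0 ≤ 320 * a ^ 2 + 10 * b ^ 2 + 4 * t := by positivity
    have h5 := (abs_le.1 (Real.abs_exp_sub_one_le (by rwa [abs_of_nonneg h4]))).2
    rw [abs_of_nonneg h4] at h5
    refine le_trans (sub_le_sub_right ?_ 1) h5
    rw [Real.exp_add (320 * a ^ 2 + 10 * b ^ 2), div_eq_mul_one_div]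
    gcongr
  refine Real.sqrt_le_iff.2 ⟨by positivity, h3.trans ?_⟩
  have h6 := Real.sq_sqrt ht
  have h7 := Real.sqrt_nonneg t
  nlinarith [mul_nonneg ha hb, mul_nonneg ha h7, mul_nonneg hb h7]

/-- The regime in which all error terms are small. Since S ≥ ρ(θ*), the third term T also dominates
t and √t for the Gaussian tail mass t; with the posterior tail this gives 3T + 2T + 2T = 7T. -/
lemma tv_pullback_le {D S : ℝ} (h : IsLocalFrame n s θs p L)
    (hp : IsRegularPrior n θs prior (2 * s) D) (hD : D ≤ √(n * d) / 6) (hs : 48 ≤ s)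
    (hfin : pullback n p L prior Set.univ < ⊤)
    (hθpos : 0 < prior θs) (hS : ∀ θ ∈ paramSpace d, prior θ ≤ S)
    (h1 : s * d / √(n * minProb θs) ≤ 1 / 40) (h2 : D / √n ≤ 1 / 40)
    (h3 : S / prior θs * Real.exp (-(1 / 128 * d * s ^ 2)) ≤ 1 / 40) :
    tv ((pullback n p L prior Set.univ)⁻¹ • pullback n p L prior)
        (stdGaussian (EuclideanSpace ℝ (Fin d))) ≤
      ENNReal.ofReal (26 * (s * d / √(n * minProb θs)) + 5 * (D / √n) +
        7 * (S / prior θs * Real.exp (-(1 / 128 * d * s ^ 2)))) := by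
  have hd : (1 : ℝ) ≤ d := by exact_mod_cast h.dim_pos
  have hDn : 0 ≤ D / √n := div_nonneg hp.bound_nonneg (Real.sqrt_nonneg _)
  set ε := s * d / √(n * minProb θs) with hε
  have hε0 : 0 ≤ ε := by positivity
  set ν := pullback n p L prior
  set γ := stdGaussian (EuclideanSpace ℝ (Fin d))
  set B := Metric.closedBall (0 : EuclideanSpace ℝ (Fin d)) (s * √d) with hBdef
  have hB : MeasurableSet B := Metric.isClosed_closedBall.measurableSet
  have : IsFiniteMeasure ν := ⟨hfin⟩
  set T := S / prior θs * Real.exp (-(1 / 128 * d * s ^ 2))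
  have hSθ : prior θs ≤ S := hS _ h.mem
  have hT : Real.exp (-(1 / 128 * d * s ^ 2)) ≤ T :=
    le_mul_of_one_le_left (Real.exp_pos _).le ((one_le_div hθpos).2 hSθ)
  have hs2 : 48 * s ≤ s ^ 2 := by nlinarith
  have hds : (0 : ℝ) ≤ d * s ^ 2 := by positivity
  have ht := measure_closedBall_compl_le (s := s) h.dim_pos (by linarith)
  set t := γ.real Bᶜ with htdef
  have ht0 : 0 ≤ t := measureReal_nonneg
  have htT : t ≤ T := ht.trans (le_trans (Real.exp_le_exp.2 (by linarith)) hT)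
  have htT' : √t ≤ T := by
    refine le_trans (Real.sqrt_le_sqrt ht) (le_trans (le_of_eq ?_)
      (le_trans (Real.exp_le_exp.2 (?_ : -(d * s ^ 2 / 16) ≤ _)) hT))
    · rw [← Real.exp_half]; congr 1; ring
    · linarith
  have hγB : γ.real B = 1 - t := by
    rw [htdef, probReal_compl_eq_one_sub hB]; ring
  have hratio : ν.real Bᶜ / ν.real Set.univ ≤ T := by
    have e1 := le_pullback_univ h hp hD
    have e2 := pullback_closedBall_compl_le h hs hS (hθpos.le.trans hSθ)
    have e1' : prior θs * Real.exp (-(d + d * s / 6)) ≤ ν.real Set.univ :=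
      (ENNReal.ofReal_le_iff_le_toReal hfin.ne).1 e1
    have e2' : ν.real Bᶜ ≤ S * Real.exp (-(d * s ^ 2 / 24)) :=
      ENNReal.toReal_le_of_le_ofReal (mul_nonneg (hθpos.le.trans hSθ) (Real.exp_pos _).le) e2
    have e3 : 0 < prior θs * Real.exp (-(d + d * s / 6)) := by positivity
    have hS0 : 0 ≤ S := hθpos.le.trans hSθ
    calc _ ≤ S * Real.exp (-(d * s ^ 2 / 24)) / (prior θs * Real.exp (-(d + d * s / 6))) :=
          div_le_div₀ (by positivity) e2' e3 e1'
      _ = S / prior θs * Real.exp (-(d * s ^ 2 / 24) - -(d + d * s / 6)) := by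
          rw [Real.exp_sub, mul_div_mul_comm]
      _ ≤ _ := by
          have h5 : 0 ≤ S / prior θs := by positivity
          refine mul_le_mul_of_nonneg_left (Real.exp_le_exp.2 ?_) h5
          -- The rate 1/24 leaves room for the loss 1 + s/6 of the normalizing constant while
          -- keeping the rate 1/128.
          have h6 : (0 : ℝ) ≤ d * (s ^ 2 / 24 - s ^ 2 / 128 - 1 - s / 6) :=
            mul_nonneg (by positivity) (by nlinarith)
          linarith
  obtain ⟨c, hc0, hct, hν⟩ := pullback_restrict_closedBall h hp
  have hf : AEMeasurable (fun x => -discr n p L prior x) (γ.restrict B) :=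
    (((continuousOn_discr h hp).mono (Metric.closedBall_subset_closedBall
      (sqrt_two_mul_le (by positivity)))).neg).aemeasurable hB
  have hγB0 : γ B ≠ 0 := by
    intro h0
    rw [measureReal_def, h0, ENNReal.toReal_zero] at hγB
    linarith
  have hM := lintegral_exp_discr_sub_le h hp (by nlinarith)
  have := tv_le_of_restrict_eq_withDensity hB hf hc0 hct hν hγB0 (Real.exp_pos _).le hM
  refine this.trans (ENNReal.ofReal_le_ofReal ?_)
  rw [hγB]
  have hfinal := sqrt_exp_div_sq_sub_one_le hε0 hDn ht0 (by linarith) (by nlinarith)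
  linarith

/-- Translates the third error term into real numbers; for an unbounded prior it is infinite. -/
lemma exp_mul_M0_sub (hd : 1 ≤ d) (hθ : 0 < prior θs)
    {Q : ℝ≥0∞} (hQ : ⨆ θ ∈ paramSpace d, ENNReal.ofReal (prior θ) = Q) (hQ0 : Q ≠ 0) (c : ℝ) :
    EReal.exp ((d : EReal) * (M0 θs prior - (c : EReal))) =
      if Q = ⊤ then ⊤ else ENNReal.ofReal (Q.toReal / prior θs * Real.exp (-(d * c))) := by
  have hd0 : (0 : ℝ) < d := by exact_mod_cast hd
  have hdE : (d : EReal) = ((d : ℝ) : EReal) := rfl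
  rw [M0, hQ]
  split_ifs with htop
  · rw [htop, ENNReal.top_div_of_ne_top ENNReal.ofReal_ne_top, ENNReal.log_top, hdE,
      EReal.top_div_of_pos_ne_top (by exact_mod_cast hd0) (EReal.coe_ne_top _), EReal.top_sub_coe,
      EReal.coe_mul_top_of_pos hd0, EReal.exp_top]
  · have hQr : 0 < Q.toReal := ENNReal.toReal_pos hQ0 htop
    rw [← ENNReal.ofReal_toReal htop, ← ENNReal.ofReal_div_of_pos hθ,
      ENNReal.log_ofReal_of_pos (by positivity), hdE, ENNReal.toReal_ofReal hQr.le]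
    rw [← EReal.coe_div, ← EReal.coe_sub, ← EReal.coe_mul, EReal.exp_coe]
    congr 1
    rw [mul_sub, mul_div_cancel₀ _ hd0.ne', sub_eq_add_neg, Real.exp_add,
      Real.exp_log (by positivity)]

lemma theta_mem_nbhd (h : 0 ≤ s) : θs ∈ nbhd n θs s := by
  change wnorm (fisher θs) (θs - θs) ≤ _
  rw [sub_self]
  have : wnorm (fisher θs) 0 = 0 := by simp [wnorm]
  rw [this]
  positivity

/-- The deterministic half of the theorem: closeness of the frequencies to θ* is all that is used of
the sample. -/
lemma tv_posterior_le (hd : 1 ≤ d) (hn : 1 ≤ n) (hθ : θs ∈ paramSpace d)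
    (hprior : ∀ θ ∈ paramSpace d, 0 ≤ prior θ)
    (hint : IntegrableOn prior (paramSpace d) volume) (hs : 48 ≤ s)
    (hc : s ^ 2 * d / (n * minProb θs) ≤ 1 / 64)
    (hδ : delta01 n θs prior (2 * s) ≤ ENNReal.ofReal (√(n * d) / 6))
    {N : Fin (d + 1) → ℕ} (hN : ∑ j, N j = n)
    (hclose : wnorm (fisher θs) (freq n N - θs) ≤ s / 2 * √((d : ℝ) / n)) :
    IsProbabilityMeasure (posterior n prior N) ∧ freq n N ∈ paramSpace d ∧
      tv (posterior n prior N) (multivariateGaussian (freq n N) ((n : ℝ) • fisher θs)⁻¹) ≤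
        ENNReal.ofReal 40 *
          (ENNReal.ofReal (s * d / √(n * minProb θs)) +
            delta01 n θs prior (2 * s) / ENNReal.ofReal (√n) +
            EReal.exp ((d : EReal) *
              (M0 θs prior - ((1 / 128 * s ^ 2 : ℝ) : EReal)))) := by
  have hn0 : (0 : ℝ) < n := by exact_mod_cast hn
  have hsn : 0 < √(n : ℝ) := Real.sqrt_pos.2 hn0
  obtain ⟨L, hL, hLi⟩ := exists_continuousLinearEquiv hθ hn0
  have h : IsLocalFrame n s θs (freq n N) L := ⟨hθ, hd, hn, by linarith, hLi, hc, hclose⟩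
  have hδt : delta01 n θs prior (2 * s) ≠ ⊤ := (hδ.trans_lt ENNReal.ofReal_lt_top).ne
  have hp := isRegularPrior_of_delta01_ne_top hδt
  set D := (delta01 n θs prior (2 * s)).toReal with hDdef
  have hD : D ≤ √(n * d) / 6 := ENNReal.toReal_le_of_le_ofReal (by positivity) hδ
  have hθpos : 0 < prior θs := hp.pos _ (theta_mem_nbhd (by linarith))
  have hfin := pullback_univ_lt_top (L := L) hn hN hprior hint
  have hpos : pullback n (freq n N) L prior Set.univ ≠ 0 := by
    have := le_pullback_univ h hp hD
    intro h0
    rw [h0, nonpos_iff_eq_zero, ENNReal.ofReal_eq_zero] at this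
    have : 0 < prior θs * Real.exp (-(d + d * s / 6)) := by positivity
    linarith
  have hm : Measurable fun x => freq n N + L x := by fun_prop
  have hprob' : IsProbabilityMeasure ((pullback n (freq n N) L prior Set.univ)⁻¹ •
      pullback n (freq n N) L prior) := by
    constructor
    rw [Measure.smul_apply, smul_eq_mul, ENNReal.inv_mul_cancel hpos hfin.ne]
  have hpost := posterior_eq_map hn hN L prior
  have hprob : IsProbabilityMeasure (posterior n prior N) := by
    rw [hpost]
    exact Measure.isProbabilityMeasure_map hm.aemeasurable
  refine ⟨hprob, h.center_mem, ?_⟩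
  have hεne : 0 ≤ s * d / √(n * minProb θs) := by
    have : 0 ≤ s := by linarith
    positivity
  have hδr : delta01 n θs prior (2 * s) / ENNReal.ofReal √n = ENNReal.ofReal (D / √n) := by
    rw [ENNReal.ofReal_div_of_pos hsn, hDdef, ENNReal.ofReal_toReal hδt]
  have hD0 : 0 ≤ D / √n := div_nonneg hp.bound_nonneg hsn.le
  set Q : ℝ≥0∞ := ⨆ θ ∈ paramSpace d, ENNReal.ofReal (prior θ) with hQ
  have hQle : ∀ θ ∈ paramSpace d, ENNReal.ofReal (prior θ) ≤ Q := fun θ hθ =>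
    le_iSup₂ (f := fun θ (_ : θ ∈ paramSpace d) => ENNReal.ofReal (prior θ)) θ hθ
  have hQ0 : Q ≠ 0 := by
    refine ((ENNReal.ofReal_pos.2 hθpos).trans_le (hQle θs hθ)).ne'
  rw [exp_mul_M0_sub hd hθpos hQ.symm hQ0, hδr]
  split_ifs with htop
  · rw [add_top, ENNReal.mul_top (by simp)]
    exact le_top
  rw [show (d : ℝ) * (1 / 128 * s ^ 2) = 1 / 128 * d * s ^ 2 by ring]
  have hT0 : 0 ≤ Q.toReal / prior θs * Real.exp (-(1 / 128 * d * s ^ 2)) := by positivity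
  rw [← ENNReal.ofReal_add hεne hD0, ← ENNReal.ofReal_add (add_nonneg hεne hD0) hT0,
    ← ENNReal.ofReal_mul (by norm_num)]
  set ε := s * d / √(n * minProb θs)
  set T := Q.toReal / prior θs * Real.exp (-(1 / 128 * d * s ^ 2))
  -- If the errors add up to at least 1/40, the factor 40 makes the bound at least one and the claim
  -- trivial; otherwise each is below 1/40.
  by_cases hbig : 1 / 40 ≤ ε + D / √n + T
  · refine (tv_le_one _ _).trans ?_
    rw [← ENNReal.ofReal_one]
    exact ENNReal.ofReal_le_ofReal (by linarith)
  rw [not_le] at hbig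
  rw [hpost, hL]
  refine (tv_map_le hm).trans ((tv_pullback_le h hp hD hs hfin hθpos
    (fun θ hθ' => (ENNReal.ofReal_le_iff_le_toReal htop).1 (hQle θ hθ'))
    (by linarith) (by linarith) (by linarith)).trans (ENNReal.ofReal_le_ofReal ?_))
  linarith

end Main

end MultinomialBvM

theorem corollary5p5 :
    ∃ s₀ c₀ C K : ℝ, 0 < s₀ ∧ 0 < c₀ ∧ 0 < C ∧ 0 < K ∧
      ∀ (d n : ℕ), 1 ≤ d → 1 ≤ n →
      ∀ θs ∈ MultinomialBvM.paramSpace d,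
      ∀ prior : EuclideanSpace ℝ (Fin d) → ℝ,
        (∀ θ ∈ MultinomialBvM.paramSpace d, 0 ≤ prior θ) →
        IntegrableOn prior (MultinomialBvM.paramSpace d) volume →
      ∀ s : ℝ, s₀ ≤ s →
        s ^ 2 * d / (n * MultinomialBvM.minProb θs) ≤ c₀ →
        MultinomialBvM.delta01 n θs prior (2 * s) ≤ ENNReal.ofReal (Real.sqrt (n * d) / 6) →
        1 - Real.exp (-(C * d * s ^ 2)) ≤
          (MultinomialBvM.multinomial n θs).real
            {N | IsProbabilityMeasure (MultinomialBvM.posterior n prior N) ∧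
              ∃ θhat : EuclideanSpace ℝ (Fin d),
                MultinomialBvM.IsMLE n N θhat ∧
                (∀ θ, MultinomialBvM.IsMLE n N θ → θ = θhat) ∧
                MultinomialBvM.tv (MultinomialBvM.posterior n prior N)
                    (multivariateGaussian θhat ((n : ℝ) • MultinomialBvM.fisher θs)⁻¹) ≤
                  ENNReal.ofReal K *
                    (ENNReal.ofReal (s * d / Real.sqrt (n * MultinomialBvM.minProb θs)) +
                      MultinomialBvM.delta01 n θs prior (2 * s) / ENNReal.ofReal (Real.sqrt n) +
                      EReal.exp ((d : EReal) *
                        (MultinomialBvM.M0 θs prior - ((C * s ^ 2 : ℝ) : EReal))))} := by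
  -- 48 makes the tail integral at most one, 1/64 gives η ≤ 1/8, 1/128 is a rate valid both for the
  -- concentration and for the tails, and 40 covers the trivial regime.
  refine ⟨48, 1 / 64, 1 / 128, 40, by norm_num, by norm_num, by norm_num, by norm_num, ?_⟩
  intro d n hd hn θs hθ prior hprior hint s hs hc hδ
  have hprob := MultinomialBvM.isProbabilityMeasure_categorical hθ
  have hfin : IsFiniteMeasure (MultinomialBvM.multinomial n θs) := by
    unfold MultinomialBvM.multinomial
    infer_instance
  refine (MultinomialBvM.multinomial_concentration hn hd hθ (by linarith) hc).trans
    (measureReal_mono ?_)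
  rintro N ⟨hN, hclose⟩
  obtain ⟨h1, h2, h3⟩ :=
    MultinomialBvM.tv_posterior_le hd hn hθ hprior hint hs hc hδ hN hclose
  obtain ⟨h4, h5⟩ := MultinomialBvM.isMLE_freq hn hN h2
  exact ⟨h1, MultinomialBvM.freq n N, h4, h5, h3⟩
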